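/- Let $d\ge 0$ be an integer and let $FT_d$ be the set of probability measures $\alpha$ on $\mathbb{R}^d$ such that $\int_{\mathbb{R}^d}\log(1+\|x\|)\,\alpha(dx)<\infty$. Let $\alpha\in FT_d$ and $t>0$. For $a_0,\ldots,a_k>0$ with sum $a$, the Dirichlet distribution $\mathcal{D}(a_0,\ldots,a_k)$ is the law of the random vector $(X_0,\ldots,X_k)$ of $\mathbb{R}^{k+1}$ with $X_i\ge 0$ and $X_0+\cdots+X_k=1$ such that $(X_1,\ldots,X_k)$ has density $\frac{\Gamma(a)}{\Gamma(a_0)\cdots\Gamma(a_k)}(1-x_1-\cdots-x_k)^{a_0-1}x_1^{a_1-1}\cdots x_k^{a_k-1}$ on $\{x_1,\ldots,x_k>0,\ x_1+\cdots+x_k<1\}$ (for $k=0$ it is the Dirac mass at $1$). Let $Y_1,B'_1,Y_2,B'_2,\ldots$ be independent random variables with $B'_j\sim\alpha$ and $Y_j\sim\beta(1,t)$, that is, $Y_j$ has density $t(1-y)^{t-1}$ on $(0,1)$. Then the series $$X_t=\sum_{j\ge 1} Y_j\Big(\prod_{i<j}(1-Y_i)\Big)B'_j$$ converges absolutely almost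 surely; denote by $\mu(t\alpha)$ the law of $X_t$ on $\mathbb{R}^d$. For every $n\ge 1$, let $W^{(n)}=(W^{(n)}_1,\ldots,W^{(n)}_n)\sim\mathcal{D}(t/n,\ldots,t/n)$ and let $B^{(n)}_1,\ldots,B^{(n)}_n$ be i.i.d. with law $\alpha$ and independent of $W^{(n)}$. Then, as $n\to\infty$, the random vectors $M_n=W^{(n)}_1B^{(n)}_1+\cdots+W^{(n)}_nB^{(n)}_n$ converge in law to $\mu(t\alpha)$. -/

import Mathlib

open MeasureTheory ProbabilityTheory Filter
open scoped Topology

namespace DirichletCurve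

/-- The density of the last `k` coordinates `(x₁, …, x_k)` of the Dirichlet distribution with
parameters `(a₀, …, a_k)`, with respect to Lebesgue measure on `ℝᵏ`. -/
noncomputable def dirichletPDFReal {k : ℕ} (a : Fin (k + 1) → ℝ) (x : Fin k → ℝ) : ℝ :=
  open scoped Classical in
  if (∀ i, 0 < x i) ∧ ∑ i, x i < 1 then
    Real.Gamma (∑ i, a i) / (∏ i, Real.Gamma (a i)) *
      ((1 - ∑ i, x i) ^ (a 0 - 1) * ∏ i : Fin k, x i ^ (a i.succ - 1))
  else 0

/-- The Dirichlet distribution `D(a₀, …, a_k)` (for `a₀, …, a_k > 0`), as a measure on `ℝᵏ⁺¹`: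
the law of `(1 - x₁ - ⋯ - x_k, x₁, …, x_k)` when `(x₁, …, x_k)` has the density above. -/
noncomputable def dirichletMeasure {k : ℕ} (a : Fin (k + 1) → ℝ) : Measure (Fin (k + 1) → ℝ) :=
  ((volume : Measure (Fin k → ℝ)).withDensity fun x => ENNReal.ofReal (dirichletPDFReal a x)).map
    fun x => Fin.cons (1 - ∑ i, x i) x

variable {d : ℕ}

/-- The class `FT_d` of the probabilities `α` on `ℝᵈ` with `∫ log (1 + ‖x‖) α(dx) < ∞`. -/
def FT (d : ℕ) : Set (ProbabilityMeasure (EuclideanSpace ℝ (Fin d))) :=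
  {α | Integrable (fun x => Real.log (1 + ‖x‖)) (α : Measure (EuclideanSpace ℝ (Fin d)))}

/-- The stick-breaking weights `W_n = Y_n (1 - Y_{n-1}) ⋯ (1 - Y_0)`, indexed from `0`. -/
noncomputable def stickWeight (y : ℕ → ℝ) (n : ℕ) : ℝ :=
  y n * ∏ k ∈ Finset.range n, (1 - y k)

/-- The law of the driving sequence `(Y_n, B_n)_n`: all the variables are independent,
`Y_n` has the law `β(1, t)` and `B_n` has the law `α`. -/
noncomputable def drivingLaw (α : ProbabilityMeasure (EuclideanSpace ℝ (Fin d)))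
    (t : ℝ) : Measure (ℕ → ℝ × EuclideanSpace ℝ (Fin d)) :=
  Measure.infinitePi fun _ : ℕ =>
    (betaMeasure 1 t).prod (α : Measure (EuclideanSpace ℝ (Fin d)))

/-- The `n`-th term `W_n B_n` of the series that defines the mean of the Dirichlet random
probability `P_t = ∑ W_n δ_{B_n}`. -/
noncomputable def meanTerm (ω : ℕ → ℝ × EuclideanSpace ℝ (Fin d)) (n : ℕ) :
    EuclideanSpace ℝ (Fin d) :=
  stickWeight (fun k => (ω k).1) n • (ω n).2

/-- The mean `X_t = ∫ x P_t(dx) = ∑ W_n B_n` of the Dirichlet random probability. -/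
noncomputable def dirichletMean (ω : ℕ → ℝ × EuclideanSpace ℝ (Fin d)) :
    EuclideanSpace ℝ (Fin d) :=
  ∑' n, meanTerm ω n

theorem isProbabilityMeasure_drivingLaw (α : ProbabilityMeasure (EuclideanSpace ℝ (Fin d)))
    (t : ℝ) (ht : 0 < t) : IsProbabilityMeasure (drivingLaw α t) := by
  have : IsProbabilityMeasure (betaMeasure 1 t) := isProbabilityMeasureBeta one_pos ht
  unfold drivingLaw
  infer_instance

theorem measurable_meanTerm (n : ℕ) :
    Measurable fun ω : ℕ → ℝ × EuclideanSpace ℝ (Fin d) => meanTerm ω n := by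
  unfold meanTerm stickWeight
  fun_prop

theorem measurable_dirichletMean :
    Measurable (dirichletMean : (ℕ → ℝ × EuclideanSpace ℝ (Fin d)) → _) :=
  Measurable.tsum measurable_meanTerm

/-- The point `μ(tα)` of the Dirichlet curve governed by `α`: the law of `X_t = ∑ W_n B_n`. -/
noncomputable def dirichletCurve (α : ProbabilityMeasure (EuclideanSpace ℝ (Fin d)))
    (t : ℝ) (ht : 0 < t) : ProbabilityMeasure (EuclideanSpace ℝ (Fin d)) :=
  ⟨(drivingLaw α t).map dirichletMean,
    have := isProbabilityMeasure_drivingLaw α t ht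
    Measure.isProbabilityMeasure_map measurable_dirichletMean.aemeasurable⟩

end DirichletCurve

/-! With `k + 1` points and all parameters equal to `t / (k + 1)`, the Dirichlet vector `W`
satisfies `W ∼ (1 - Y) W + Y e_J`, where `Y ∼ β(1, t)`, `J` is uniform on the indices, and `Y`, `J`,
`W` on the right are independent. Iterating `m` times shows that the mixture `∑ W_i B_i` has the law
of a stick-breaking sum `∑_{j<m} w_j B_{J_j}` plus a remainder `∏_{j<m} (1 - Y_j)` times a mixture
(`map_stickSum_add_stickRest`). The stick-breaking weights are those of the limit `X_t`; only the
repetitions among the `J_j` distinguish the two sums.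

Let `p k m` be the integral of a bounded Lipschitz `f` against the law of the truncated sum. As `m →
∞` the remainder dies and `p k m` tends to the integral for the mixture. As `k → ∞` with `m` fixed,
a collision among `m` indices has probability at most `m² / (k + 1)`, so `p k m` tends to the
integral for the `m`-th partial sum of `X_t`. The limits may be exchanged because `p k (m + 1) - p k
m` is bounded by a summable sequence free of `k`; this is where the logarithmic moment enters
(`exists_tsum_tailBound_ne_top`).

The fixed point equation comes from Gamma variables: a Gamma vector is its total times an
independent Dirichlet vector, weighting by one coordinate adds an independent exponential to it, and
Beta–Gamma algebra splits the new total. -/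

namespace DirichletCurve

open scoped ENNReal

/-! ### Gamma laws of rate one -/

/-- The density of the Gamma distribution with rate `1`, vanishing on `(-∞, 0]`. -/
noncomputable def gammaDensity (a x : ℝ) : ℝ :=
  if 0 < x then x ^ (a - 1) * Real.exp (-x) / Real.Gamma a else 0

theorem gammaDensity_of_pos {a x : ℝ} (hx : 0 < x) :
    gammaDensity a x = x ^ (a - 1) * Real.exp (-x) / Real.Gamma a := if_pos hx

theorem gammaDensity_of_nonpos {a x : ℝ} (hx : x ≤ 0) : gammaDensity a x = 0 :=
  if_neg hx.not_gt

theorem gammaDensity_nonneg {a : ℝ} (ha : 0 < a) (x : ℝ) : 0 ≤ gammaDensity a x := by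
  unfold gammaDensity
  have := Real.Gamma_pos_of_pos ha
  split_ifs <;> positivity

@[fun_prop]
theorem measurable_gammaDensity (a : ℝ) : Measurable (gammaDensity a) :=
  Measurable.ite measurableSet_Ioi (by fun_prop) measurable_const

theorem gammaMeasure_one_eq (a : ℝ) :
    gammaMeasure a 1 = volume.withDensity fun x => ENNReal.ofReal (gammaDensity a x) := by
  refine withDensity_congr_ae ?_
  filter_upwards [Measure.ae_ne volume (0 : ℝ)] with x hx
  unfold gammaPDF gammaPDFReal gammaDensity
  congr 1
  rcases lt_or_gt_of_ne hx with h | h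
  · rw [if_neg h.not_ge, if_neg h.not_gt]
  · rw [if_pos h.le, if_pos h, Real.one_rpow, one_mul]; ring

theorem lintegral_gammaMeasure_one (a : ℝ) {f : ℝ → ℝ≥0∞} (hf : Measurable f) :
    ∫⁻ x, f x ∂gammaMeasure a 1 = ∫⁻ x, ENNReal.ofReal (gammaDensity a x) * f x := by
  rw [gammaMeasure_one_eq, lintegral_withDensity_eq_lintegral_mul _ (by fun_prop) hf]
  rfl

theorem ae_pos_gammaMeasure_one (a : ℝ) : ∀ᵐ x ∂gammaMeasure a 1, 0 < x := by
  rw [gammaMeasure_one_eq, ae_withDensity_iff (by fun_prop)]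
  refine .of_forall fun x hx => ?_
  by_contra h
  exact hx (by rw [gammaDensity_of_nonpos (not_lt.1 h), ENNReal.ofReal_zero])

/-! ### Change of variables to total mass and proportions -/

section Polar

variable {V : Type*} [NormedAddCommGroup V] [NormedSpace ℝ V] [MeasurableSpace V] [BorelSpace V]
  [FiniteDimensional ℝ V] (μ : Measure V) [μ.IsAddHaarMeasure]

theorem lintegral_eq_rpow_mul_lintegral_smul {r : ℝ} (hr : 0 < r) {g : V → ℝ≥0∞}
    (hg : Measurable g) :
    ∫⁻ v, g v ∂μ = ENNReal.ofReal (r ^ Module.finrank ℝ V) * ∫⁻ v, g (r • v) ∂μ := by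
  have h : ∫⁻ v, g (r • v) ∂μ = ∫⁻ v, g v ∂(μ.map (r • ·)) := by
    rw [lintegral_map hg (by fun_prop)]
  have hp : 0 < r ^ Module.finrank ℝ V := by positivity
  rw [h, Measure.map_addHaar_smul μ hr.ne', lintegral_smul_measure, smul_eq_mul, ← mul_assoc,
    ← ENNReal.ofReal_mul hp.le, abs_of_pos (inv_pos.2 hp), mul_inv_cancel₀ hp.ne',
    ENNReal.ofReal_one, one_mul]

/-- Integration in the coordinates `(r, x)` given by `p = r (1 - ℓ x)`, `v = r x`. -/
theorem lintegral_lintegral_eq_polar (ℓ : V →L[ℝ] ℝ) {H : ℝ × V → ℝ≥0∞} (hH : Measurable H)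
    (h0 : ∀ p v, p + ℓ v ≤ 0 → H (p, v) = 0) :
    ∫⁻ v, (∫⁻ p, H (p, v)) ∂μ = ∫⁻ r in Set.Ioi (0 : ℝ),
      ENNReal.ofReal (r ^ Module.finrank ℝ V) * ∫⁻ x, H (r * (1 - ℓ x), r • x) ∂μ := by
  have : SecondCountableTopology V := by
    have := FiniteDimensional.proper_real V
    infer_instance
  calc ∫⁻ v, (∫⁻ p, H (p, v)) ∂μ = ∫⁻ v, (∫⁻ r, H (r - ℓ v, v)) ∂μ := by
        refine lintegral_congr fun v => ?_
        rw [lintegral_sub_right_eq_self (fun p => H (p, v))]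
    _ = ∫⁻ r, ∫⁻ v, H (r - ℓ v, v) ∂μ := by
        rw [lintegral_lintegral_swap]
        exact Measurable.aemeasurable (by fun_prop)
    _ = ∫⁻ r in Set.Ioi (0 : ℝ), ∫⁻ v, H (r - ℓ v, v) ∂μ := by
        rw [← lintegral_indicator measurableSet_Ioi]
        refine lintegral_congr fun r => ?_
        by_cases hr : 0 < r
        · rw [Set.indicator_of_mem (by exact hr)]
        · rw [Set.indicator_of_notMem (by exact hr)]
          -- Here `p + ℓ v = r ≤ 0`, so negative radii contribute nothing.
          have h1 : ∀ v, H (r - ℓ v, v) = 0 := fun v => h0 _ _ (by simpa using hr)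
          simp [h1]
    _ = _ := by
        refine setLIntegral_congr_fun measurableSet_Ioi fun r hr => ?_
        rw [lintegral_eq_rpow_mul_lintegral_smul μ hr (g := fun v => H (r - ℓ v, v)) (by fun_prop)]
        simp only [map_smul, smul_eq_mul, mul_sub, mul_one]

end Polar

/-! ### Beta–Gamma algebra -/

/-- The leading `r` is the Jacobian of `(r, y) ↦ (r (1 - y), r y)`. The exponentials recombine into
`exp (-r)`; outside `0 < y < 1` one Gamma density vanishes together with the Beta density. -/
theorem gammaDensity_mul_gammaDensity_one {t r y : ℝ} (ht : 0 < t) (hr : 0 < r) :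
    r * (gammaDensity 1 (r * y) * gammaDensity t (r * (1 - y)))
      = gammaDensity (t + 1) r * betaPDFReal 1 t y := by
  unfold betaPDFReal
  split_ifs with h
  · obtain ⟨h0, h1⟩ := h
    have h1' : 0 < 1 - y := by linarith
    have hG := (Real.Gamma_pos_of_pos ht).ne'
    rw [gammaDensity_of_pos (by positivity), gammaDensity_of_pos (by positivity),
      gammaDensity_of_pos hr, beta, Real.Gamma_one, add_comm (1 : ℝ) t, Real.Gamma_add_one ht.ne',
      Real.mul_rpow hr.le h1'.le]
    have e1 : Real.exp (-r) = Real.exp (-(r * y)) * Real.exp (-(r * (1 - y))) := by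
      rw [← Real.exp_add]; congr 1; ring
    have e2 : r ^ (t + 1 - 1) = r * r ^ (t - 1) := by
      rw [← Real.rpow_one_add' hr.le (by linarith)]; congr 1; ring
    rw [e1, e2]
    simp only [sub_self, Real.rpow_zero]
    field_simp
  · rw [mul_zero]
    rcases not_and_or.1 h with h | h
    · rw [gammaDensity_of_nonpos (x := r * y) (by nlinarith)]; ring
    · rw [gammaDensity_of_nonpos (x := r * (1 - y)) (by nlinarith)]; ring

/-- Beta–Gamma algebra: if `R ∼ Γ(t + 1)` and `Y ∼ β(1, t)` are independent then
`R (1 - Y) ∼ Γ(t)` and `R Y ∼ Γ(1)` are independent. -/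
theorem lintegral_gamma_gamma_one {t : ℝ} (ht : 0 < t) {f : ℝ × ℝ → ℝ≥0∞} (hf : Measurable f) :
    ∫⁻ e, ∫⁻ p, f (p, e) ∂gammaMeasure t 1 ∂gammaMeasure 1 1
      = ∫⁻ r, ∫⁻ y, f (r * (1 - y), r * y) ∂betaMeasure 1 t ∂gammaMeasure (t + 1) 1 := by
  have : SFinite (gammaMeasure t 1) := by unfold gammaMeasure; infer_instance
  have : SFinite (betaMeasure 1 t) := by unfold betaMeasure; infer_instance
  have hb : Measurable (betaPDF 1 t) := by unfold betaPDF; fun_prop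
  rw [lintegral_gammaMeasure_one _ (by fun_prop), lintegral_gammaMeasure_one _ (by fun_prop)]
  let H : ℝ × ℝ → ℝ≥0∞ := fun q =>
    ENNReal.ofReal (gammaDensity 1 q.2) * (ENNReal.ofReal (gammaDensity t q.1) * f q)
  have hH : Measurable H := by fun_prop
  have key := lintegral_lintegral_eq_polar (volume : Measure ℝ) (ContinuousLinearMap.id ℝ ℝ) hH ?_
  · calc _ = ∫⁻ v, ∫⁻ p, H (p, v) := by
          refine lintegral_congr fun e => ?_
          rw [lintegral_gammaMeasure_one _ (by fun_prop), ← lintegral_const_mul _ (by fun_prop)]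
      _ = _ := key
      _ = _ := by
          rw [← lintegral_indicator measurableSet_Ioi]
          refine lintegral_congr fun r => ?_
          by_cases hr : 0 < r
          · rw [Set.indicator_of_mem (by exact hr)]
            rw [betaMeasure, lintegral_withDensity_eq_lintegral_mul _ hb (by fun_prop),
              ← lintegral_const_mul _ (by fun_prop), ← lintegral_const_mul _ (by fun_prop)]
            refine lintegral_congr fun y => ?_
            simp only [H, ContinuousLinearMap.id_apply, smul_eq_mul, Module.finrank_self, pow_one,
              Pi.mul_apply, betaPDF]
            rw [← mul_assoc (ENNReal.ofReal (gammaDensity 1 _)),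
              ← ENNReal.ofReal_mul (gammaDensity_nonneg one_pos _), ← mul_assoc,
              ← ENNReal.ofReal_mul hr.le, gammaDensity_mul_gammaDensity_one ht hr,
              ENNReal.ofReal_mul (gammaDensity_nonneg (by linarith) _), mul_assoc]
          · rw [Set.indicator_of_notMem (by exact hr), gammaDensity_of_nonpos (not_lt.1 hr)]
            simp
  · intro p v h
    simp only [ContinuousLinearMap.id_apply] at h
    simp only [H]
    rcases le_or_gt v 0 with hv | hv
    · rw [gammaDensity_of_nonpos hv]; simp
    · rw [gammaDensity_of_nonpos (x := p) (by linarith)]; simp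

/-! ### Densities of product measures -/

section PiDensity

theorem lintegral_fin_prod_eq_prod {n : ℕ} {f : Fin n → ℝ → ℝ≥0∞} (hf : ∀ i, Measurable (f i)) :
    ∫⁻ x : Fin n → ℝ, ∏ i, f i (x i) = ∏ i, ∫⁻ x, f i x := by
  induction n with
  | zero => simp [volume_pi]
  | succ n ih =>
    rw [← ((volume_preserving_piFinSuccAbove (fun _ => ℝ) (0 : Fin (n + 1))).symm).lintegral_comp
      (by fun_prop)]
    simp only [MeasurableEquiv.piFinSuccAbove_symm_apply, Fin.insertNthEquiv_apply,
      Fin.prod_univ_succ, Fin.insertNth_zero', Fin.cons_zero, Fin.cons_succ]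
    rw [← ih fun i => hf i.succ, Measure.volume_eq_prod,
      lintegral_prod_mul (f := f 0) (g := fun x : Fin n → ℝ => ∏ i, f i.succ (x i))
      (hf 0).aemeasurable (Finset.measurable_fun_prod _ fun i _ =>
        (hf i.succ).comp (measurable_pi_apply i)).aemeasurable]

theorem pi_withDensity {n : ℕ} {f : Fin n → ℝ → ℝ≥0∞} (hf : ∀ i, Measurable (f i))
    [∀ i, SigmaFinite ((volume : Measure ℝ).withDensity (f i))] :
    Measure.pi (fun i => (volume : Measure ℝ).withDensity (f i))
      = (volume : Measure (Fin n → ℝ)).withDensity fun x => ∏ i, f i (x i) := by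
  refine Measure.pi_eq fun s hs => ?_
  rw [withDensity_apply _ (MeasurableSet.univ_pi hs),
    ← lintegral_indicator (MeasurableSet.univ_pi hs)]
  have : ∀ x : Fin n → ℝ, (Set.univ.pi s).indicator (fun x => ∏ i, f i (x i)) x
      = ∏ i, (s i).indicator (f i) (x i) := by
    intro x
    by_cases hx : x ∈ Set.univ.pi s
    · rw [Set.indicator_of_mem hx]
      exact Finset.prod_congr rfl fun i _ => (Set.indicator_of_mem (hx i trivial) _).symm
    · rw [Set.indicator_of_notMem hx]
      simp only [Set.mem_pi, Set.mem_univ, true_implies, not_forall] at hx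
      obtain ⟨i, hi⟩ := hx
      exact (Finset.prod_eq_zero (Finset.mem_univ i) (Set.indicator_of_notMem hi _)).symm
  simp_rw [this]
  rw [lintegral_fin_prod_eq_prod fun i => (hf i).indicator (hs i)]
  refine Finset.prod_congr rfl fun i _ => ?_
  rw [lintegral_indicator (hs i), withDensity_apply _ (hs i)]

end PiDensity

/-! ### Dirichlet vectors as proportions of independent Gamma variables -/

section Dirichlet

variable {k : ℕ} {a : Fin (k + 1) → ℝ}

@[fun_prop]
theorem measurable_dirichletPDFReal (a : Fin (k + 1) → ℝ) : Measurable (dirichletPDFReal a) := by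
  classical
  have h1 : MeasurableSet {x : Fin k → ℝ | ∀ i, 0 < x i} := by
    simp only [Set.ofPred_forall]
    exact MeasurableSet.iInter fun i => measurableSet_lt measurable_const (measurable_pi_apply i)
  have h2 : MeasurableSet {x : Fin k → ℝ | ∑ i, x i < 1} :=
    measurableSet_lt (by fun_prop) measurable_const
  exact Measurable.ite (h1.inter h2) (by fun_prop) measurable_const

theorem measurable_consOneSub :
    Measurable fun x : Fin k → ℝ => (Fin.cons (1 - ∑ i, x i) x : Fin (k + 1) → ℝ) := by
  refine measurable_pi_lambda _ fun i => ?_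
  refine Fin.cases ?_ (fun i => ?_) i
  · simp only [Fin.cons_zero]; fun_prop
  · simp only [Fin.cons_succ]; fun_prop

theorem lintegral_dirichletMeasure (a : Fin (k + 1) → ℝ) {f : (Fin (k + 1) → ℝ) → ℝ≥0∞}
    (hf : Measurable f) :
    ∫⁻ w, f w ∂dirichletMeasure a = ∫⁻ x : Fin k → ℝ, ENNReal.ofReal (dirichletPDFReal a x) *
      f (Fin.cons (1 - ∑ i, x i) x) := by
  rw [dirichletMeasure, lintegral_map hf measurable_consOneSub]
  exact lintegral_withDensity_eq_lintegral_mul _ (by fun_prop) (hf.comp measurable_consOneSub)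

theorem ae_sum_eq_one_dirichletMeasure (a : Fin (k + 1) → ℝ) :
    ∀ᵐ w ∂dirichletMeasure a, ∑ i, w i = 1 := by
  rw [dirichletMeasure, ae_map_iff measurable_consOneSub.aemeasurable
    (measurableSet_eq_fun (by fun_prop) measurable_const)]
  exact .of_forall fun x => by simp [Fin.sum_univ_succ]

/-- The density identity behind the independence of total and proportions: `r ^ k` is the Jacobian,
and off the open simplex some coordinate is nonpositive, so both sides vanish. -/
theorem prod_gammaDensity_smul (ha : ∀ i, 0 < a i) {r : ℝ} (hr : 0 < r) (x : Fin k → ℝ) :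
    r ^ k * ∏ i, gammaDensity (a i) (r * (Fin.cons (1 - ∑ i, x i) x : Fin (k + 1) → ℝ) i)
      = gammaDensity (∑ i, a i) r * dirichletPDFReal a x := by
  unfold dirichletPDFReal
  split_ifs with h
  · obtain ⟨h0, h1⟩ := h
    set w : Fin (k + 1) → ℝ := Fin.cons (1 - ∑ i, x i) x with hw
    have hw0 : ∀ i, 0 < w i := by
      intro i
      refine Fin.cases ?_ (fun i => ?_) i
      · simp only [hw, Fin.cons_zero]; linarith
      · simpa [hw] using h0 i
    have hw1 : ∑ i, w i = 1 := by simp [hw, Fin.sum_univ_succ]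
    have hprod : (1 - ∑ i, x i) ^ (a 0 - 1) * ∏ i : Fin k, x i ^ (a i.succ - 1)
        = ∏ i, w i ^ (a i - 1) := by simp [hw, Fin.prod_univ_succ]
    have hsum : 0 < ∑ i, a i := Finset.sum_pos (fun i _ => ha i) Finset.univ_nonempty
    have hG : ∏ i, Real.Gamma (a i) ≠ 0 :=
      Finset.prod_ne_zero_iff.2 fun i _ => (Real.Gamma_pos_of_pos (ha i)).ne'
    have hG' := (Real.Gamma_pos_of_pos hsum).ne'
    have e1 : ∀ i, gammaDensity (a i) (r * w i) = r ^ (a i - 1) * w i ^ (a i - 1) *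
        Real.exp (-(r * w i)) / Real.Gamma (a i) := fun i => by
      rw [gammaDensity_of_pos (mul_pos hr (hw0 i)), Real.mul_rpow hr.le (hw0 i).le]
    have e2 : ∏ i, Real.exp (-(r * w i)) = Real.exp (-r) := by
      rw [← Real.exp_sum, Finset.sum_neg_distrib, ← Finset.mul_sum, hw1, mul_one]
    -- The product has `k + 1` factors, so the exponents add up to `k + ∑ a i - (k + 1)`.
    have e3 : r ^ k * ∏ i, r ^ (a i - 1) = r ^ (∑ i, a i - 1) := by
      rw [← Real.rpow_sum_of_pos hr, ← Real.rpow_natCast, ← Real.rpow_add hr]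
      congr 1
      simp
      ring
    rw [hprod, gammaDensity_of_pos hr, Finset.prod_congr rfl fun i _ => e1 i]
    simp only [Finset.prod_div_distrib, Finset.prod_mul_distrib]
    rw [e2, ← e3]
    field_simp
  · rw [mul_zero]
    have : ∃ i, (Fin.cons (1 - ∑ i, x i) x : Fin (k + 1) → ℝ) i ≤ 0 := by
      rcases not_and_or.1 h with h | h
      · push Not at h
        obtain ⟨i, hi⟩ := h
        exact ⟨i.succ, by simpa using hi⟩
      · exact ⟨0, by simpa using h⟩
    obtain ⟨i, hi⟩ := this
    rw [Finset.prod_eq_zero (Finset.mem_univ i)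
      (gammaDensity_of_nonpos (mul_nonpos_of_nonneg_of_nonpos hr.le hi)), mul_zero]

instance (a : Fin (k + 1) → ℝ) : SFinite (dirichletMeasure a) := by
  unfold dirichletMeasure; infer_instance

/-- A vector of independent Gamma variables is the product of its sum, which is a Gamma variable,
and of an independent Dirichlet vector. -/
theorem lintegral_pi_gammaMeasure (ha : ∀ i, 0 < a i) {f : (Fin (k + 1) → ℝ) → ℝ≥0∞}
    (hf : Measurable f) :
    ∫⁻ g, f g ∂Measure.pi (fun i => gammaMeasure (a i) 1)
      = ∫⁻ r, ∫⁻ w, f (r • w) ∂dirichletMeasure a ∂gammaMeasure (∑ i, a i) 1 := by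
  have hpi : Measure.pi (fun i => gammaMeasure (a i) 1) = (volume : Measure _).withDensity
      fun x => ∏ i, ENNReal.ofReal (gammaDensity (a i) (x i)) := by
    simp only [gammaMeasure_one_eq]
    have (i : Fin (k + 1)) : SigmaFinite ((volume : Measure ℝ).withDensity
        fun x => ENNReal.ofReal (gammaDensity (a i) x)) := by
      rw [← gammaMeasure_one_eq]
      have := isProbabilityMeasure_gammaMeasure (ha i) one_pos
      infer_instance
    exact pi_withDensity fun i => by fun_prop
  rw [hpi, lintegral_withDensity_eq_lintegral_mul _ (by fun_prop) hf,
    lintegral_gammaMeasure_one _ (by fun_prop),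
    ← ((volume_preserving_piFinSuccAbove (fun _ => ℝ) (0 : Fin (k + 1))).symm).lintegral_comp
      (by fun_prop)]
  let F : (Fin (k + 1) → ℝ) → ℝ≥0∞ := fun y =>
    (∏ i, ENNReal.ofReal (gammaDensity (a i) (y i))) * f y
  have hF : Measurable F := by fun_prop
  let e := (MeasurableEquiv.piFinSuccAbove (fun _ : Fin (k + 1) => ℝ) 0).symm
  have he : ∀ p v, e (p, v) = Fin.cons p v := fun p v => by
    simp [e, MeasurableEquiv.piFinSuccAbove_symm_apply, Fin.consEquiv]
  have hH : Measurable fun q : ℝ × (Fin k → ℝ) => F (e q) := hF.comp e.measurable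
  let ℓ : (Fin k → ℝ) →L[ℝ] ℝ := ∑ i, ContinuousLinearMap.proj i
  have hℓ : ∀ v, ℓ v = ∑ i, v i := fun v => by simp [ℓ]
  have key := lintegral_lintegral_eq_polar (volume : Measure (Fin k → ℝ)) ℓ hH ?_
  · calc _ = ∫⁻ q : ℝ × (Fin k → ℝ), F (e q) := rfl
      _ = ∫⁻ v : Fin k → ℝ, ∫⁻ p : ℝ, F (e (p, v)) := by
        rw [Measure.volume_eq_prod, lintegral_prod_symm _ hH.aemeasurable]
      _ = _ := key
      _ = _ := by
        rw [← lintegral_indicator measurableSet_Ioi]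
        refine lintegral_congr fun r => ?_
        by_cases hr : 0 < r
        · rw [Set.indicator_of_mem (by exact hr), lintegral_dirichletMeasure _ (by fun_prop),
            ← lintegral_const_mul _ (by fun_prop),
            ← lintegral_const_mul (f := fun x : Fin k → ℝ => ENNReal.ofReal (dirichletPDFReal a x) *
              f (r • (Fin.cons (1 - ∑ i, x i) x : Fin (k + 1) → ℝ))) _
              (Measurable.mul (by fun_prop) ?_)]
          · refine lintegral_congr fun x => ?_
            have hx : e (r * (1 - ℓ x), r • x)
                = r • (Fin.cons (1 - ∑ i, x i) x : Fin (k + 1) → ℝ) := by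
              rw [he, hℓ]
              ext i
              refine Fin.cases ?_ (fun i => ?_) i <;> simp
            simp only [hx, F]
            rw [← mul_assoc, ← mul_assoc, ← ENNReal.ofReal_prod_of_nonneg
              (fun i _ => gammaDensity_nonneg (ha i) _), ← ENNReal.ofReal_mul (by positivity),
              ← ENNReal.ofReal_mul (gammaDensity_nonneg
                (Finset.sum_pos (fun i _ => ha i) Finset.univ_nonempty) _),
              ← prod_gammaDensity_smul ha hr]
            simp only [Module.finrank_fin_fun, Pi.smul_apply, smul_eq_mul]
          · exact (hf.comp (measurable_const_smul r)).comp measurable_consOneSub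
        · rw [Set.indicator_of_notMem (by exact hr), gammaDensity_of_nonpos (not_lt.1 hr)]
          simp
  · intro p v h
    rw [hℓ] at h
    rw [he]
    have : ∃ i, (Fin.cons p v : Fin (k + 1) → ℝ) i ≤ 0 := by
      by_contra! hc
      have := Finset.sum_pos (fun i _ => hc i) Finset.univ_nonempty
      rw [Fin.sum_univ_succ] at this
      simp only [Fin.cons_zero, Fin.cons_succ] at this
      linarith
    obtain ⟨i, hi⟩ := this
    simp only [F]
    rw [Finset.prod_eq_zero (Finset.mem_univ i) (by rw [gammaDensity_of_nonpos hi]; simp), zero_mul]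

end Dirichlet

/-! ### Size-biasing and the Dirichlet fixed point equation -/

/-- Size-biasing raises the Gamma parameter by one, since `Γ(a + 1) = a Γ(a)`. -/
theorem lintegral_gammaMeasure_add_one {a : ℝ} (ha : 0 < a) {h : ℝ → ℝ≥0∞} (hh : Measurable h) :
    ∫⁻ x, ENNReal.ofReal x * h x ∂gammaMeasure a 1
      = ENNReal.ofReal a * ∫⁻ x, h x ∂gammaMeasure (a + 1) 1 := by
  rw [lintegral_gammaMeasure_one _ (by fun_prop), lintegral_gammaMeasure_one _ hh,
    ← lintegral_const_mul _ (by fun_prop)]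
  refine lintegral_congr fun x => ?_
  rw [← mul_assoc, ← mul_assoc, ← ENNReal.ofReal_mul (gammaDensity_nonneg ha _),
    ← ENNReal.ofReal_mul ha.le]
  congr 2
  rcases le_or_gt x 0 with hx | hx
  · simp [gammaDensity_of_nonpos hx]
  · have := (Real.Gamma_pos_of_pos ha).ne'
    rw [gammaDensity_of_pos hx, gammaDensity_of_pos hx, Real.Gamma_add_one ha.ne']
    have e2 : x ^ (a + 1 - 1) = x * x ^ (a - 1) := by
      rw [← Real.rpow_one_add' hx.le (by linarith)]; congr 1; ring
    rw [e2]
    field_simp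

theorem lintegral_gammaMeasure_add_one_eq_conv {a : ℝ} (ha : 0 < a) {h : ℝ → ℝ≥0∞}
    (hh : Measurable h) :
    ∫⁻ x, h x ∂gammaMeasure (a + 1) 1
      = ∫⁻ e, ∫⁻ p, h (p + e) ∂gammaMeasure a 1 ∂gammaMeasure 1 1 := by
  have := isProbabilityMeasureBeta one_pos ha
  rw [lintegral_gamma_gamma_one ha (f := fun q => h (q.1 + q.2)) (by fun_prop)]
  refine lintegral_congr fun r => ?_
  have : ∀ y, r * (1 - y) + r * y = r := fun y => by ring
  simp [this]

variable {k : ℕ} {a : Fin (k + 1) → ℝ}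

/-- Conditionally on the other coordinates, weighting by `g j` turns `Γ(a j)` into `Γ(a j + 1)`, the
law of `g j` plus an independent exponential. -/
theorem lintegral_pi_gammaMeasure_mul_eval (ha : ∀ i, 0 < a i) (j : Fin (k + 1))
    {h : (Fin (k + 1) → ℝ) → ℝ≥0∞} (hh : Measurable h) :
    ∫⁻ g, ENNReal.ofReal (g j) * h g ∂Measure.pi (fun i => gammaMeasure (a i) 1)
      = ENNReal.ofReal (a j) * ∫⁻ e, ∫⁻ g, h (g + e • Pi.single j 1)
          ∂Measure.pi (fun i => gammaMeasure (a i) 1) ∂gammaMeasure 1 1 := by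
  have (i : Fin (k + 1)) : IsProbabilityMeasure (gammaMeasure (a i) 1) :=
    isProbabilityMeasure_gammaMeasure (ha i) one_pos
  have : IsProbabilityMeasure (gammaMeasure 1 1) :=
    isProbabilityMeasure_gammaMeasure one_pos one_pos
  let μ : Fin (k + 1) → Measure ℝ := fun i => gammaMeasure (a i) 1
  have (i : Fin (k + 1)) : IsProbabilityMeasure (μ i) :=
    isProbabilityMeasure_gammaMeasure (ha i) one_pos
  let E := (MeasurableEquiv.piFinSuccAbove (fun _ : Fin (k + 1) => ℝ) j).symm
  have hE : ∀ p v, E (p, v) = j.insertNth p v := fun p v => by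
    simp [E, MeasurableEquiv.piFinSuccAbove_symm_apply, Fin.insertNthEquiv]
  have split : ∀ F : (Fin (k + 1) → ℝ) → ℝ≥0∞, Measurable F →
      ∫⁻ g, F g ∂Measure.pi μ = ∫⁻ v, ∫⁻ p, F (E (p, v)) ∂μ j
        ∂Measure.pi (fun i => μ (j.succAbove i)) := by
    intro F hF
    rw [← ((measurePreserving_piFinSuccAbove μ j).symm).lintegral_comp hF,
      lintegral_prod_symm _ (by fun_prop)]
  change ∫⁻ g, _ ∂Measure.pi μ = _ * ∫⁻ e, ∫⁻ g, _ ∂Measure.pi μ ∂_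
  rw [split _ (by fun_prop)]
  have hadd : ∀ p v (e : ℝ), E (p, v) + e • Pi.single j 1 = E (p + e, v) := by
    intro p v e
    ext i
    rw [hE, hE]
    refine j.succAboveCases ?_ (fun i => ?_) i
    · simp
    · simp
  have : ∀ e : ℝ, ∫⁻ g, h (g + e • Pi.single j 1) ∂Measure.pi μ
      = ∫⁻ v, ∫⁻ p, h (E (p + e, v)) ∂μ j ∂Measure.pi (fun i => μ (j.succAbove i)) := by
    intro e
    rw [split _ (by fun_prop)]
    simp_rw [hadd]
  simp_rw [this]
  rw [lintegral_lintegral_swap (μ := gammaMeasure 1 1) (by fun_prop),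
    ← lintegral_const_mul _ (by fun_prop)]
  refine lintegral_congr fun v => ?_
  have hj : ∀ p, E (p, v) j = p := fun p => by rw [hE]; simp
  simp_rw [hj]
  rw [lintegral_gammaMeasure_add_one (ha j) (h := fun p => h (E (p, v))) (by fun_prop),
    lintegral_gammaMeasure_add_one_eq_conv (ha j) (h := fun p => h (E (p, v))) (by fun_prop)]

theorem sum_pos_of_pos (ha : ∀ i, 0 < a i) : 0 < ∑ i, a i :=
  Finset.sum_pos (fun i _ => ha i) Finset.univ_nonempty

/-- Integrating `1` in the Gamma decomposition gives the total mass without computing the Dirichlet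
integral. -/
theorem isProbabilityMeasure_dirichletMeasure (ha : ∀ i, 0 < a i) :
    IsProbabilityMeasure (dirichletMeasure a) := by
  have (i : Fin (k + 1)) : IsProbabilityMeasure (gammaMeasure (a i) 1) :=
    isProbabilityMeasure_gammaMeasure (ha i) one_pos
  have := isProbabilityMeasure_gammaMeasure (sum_pos_of_pos ha) one_pos
  have h := lintegral_pi_gammaMeasure ha (f := fun _ => 1) measurable_const
  constructor
  simpa using h.symm

/-- Division of a vector by the sum of its coordinates. -/
noncomputable def normalize (g : Fin (k + 1) → ℝ) : Fin (k + 1) → ℝ := (∑ i, g i)⁻¹ • g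

@[fun_prop]
theorem measurable_normalize : Measurable (normalize (k := k)) := by
  unfold normalize; fun_prop

theorem normalize_smul {r : ℝ} (hr : r ≠ 0) {w : Fin (k + 1) → ℝ} (hw : ∑ i, w i = 1) :
    normalize (r • w) = w := by
  have : ∑ i, (r • w) i = r := by
    simp only [Pi.smul_apply, smul_eq_mul, ← Finset.mul_sum, hw, mul_one]
  rw [normalize, this, smul_smul, inv_mul_cancel₀ hr, one_smul]

/-- The distributional fixed point equation of the Dirichlet distribution. -/
theorem lintegral_dirichletMeasure_eq_sum (ha : ∀ i, 0 < a i) {f : (Fin (k + 1) → ℝ) → ℝ≥0∞}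
    (hf : Measurable f) :
    ENNReal.ofReal (∑ i, a i) * ∫⁻ w, f w ∂dirichletMeasure a
      = ∑ j, ENNReal.ofReal (a j) * ∫⁻ y, ∫⁻ w, f ((1 - y) • w + y • Pi.single j 1)
          ∂dirichletMeasure a ∂betaMeasure 1 (∑ i, a i) := by
  have hs := sum_pos_of_pos ha
  have (i : Fin (k + 1)) : IsProbabilityMeasure (gammaMeasure (a i) 1) :=
    isProbabilityMeasure_gammaMeasure (ha i) one_pos
  have : IsProbabilityMeasure (gammaMeasure (∑ i, a i + 1) 1) :=
    isProbabilityMeasure_gammaMeasure (by linarith) one_pos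
  have : IsProbabilityMeasure (gammaMeasure (∑ i, a i) 1) :=
    isProbabilityMeasure_gammaMeasure hs one_pos
  have := isProbabilityMeasure_dirichletMeasure ha
  -- A dummy radius of law `Γ(∑ a i + 1)` is a size-biased `Γ(∑ a i)`. It creates the weight `r = ∑
  -- g i`, which can then be distributed over the coordinates.
  calc ENNReal.ofReal (∑ i, a i) * ∫⁻ w, f w ∂dirichletMeasure a
      = ENNReal.ofReal (∑ i, a i) * ∫⁻ _, ∫⁻ w, f w ∂dirichletMeasure a
          ∂gammaMeasure (∑ i, a i + 1) 1 := by simp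
    _ = ∫⁻ r, ENNReal.ofReal r * ∫⁻ w, f w ∂dirichletMeasure a ∂gammaMeasure (∑ i, a i) 1 :=
        (lintegral_gammaMeasure_add_one hs measurable_const).symm
    _ = ∫⁻ r, ∫⁻ w, ENNReal.ofReal (∑ i, (r • w) i) * f (normalize (r • w)) ∂dirichletMeasure a
          ∂gammaMeasure (∑ i, a i) 1 := by
        refine lintegral_congr_ae ?_
        filter_upwards [ae_pos_gammaMeasure_one _] with r hr
        rw [← lintegral_const_mul _ hf]
        refine lintegral_congr_ae ?_
        filter_upwards [ae_sum_eq_one_dirichletMeasure a] with w hw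
        rw [normalize_smul hr.ne' hw]
        simp only [Pi.smul_apply, smul_eq_mul, ← Finset.mul_sum, hw, mul_one]
    _ = ∫⁻ g, ENNReal.ofReal (∑ i, g i) * f (normalize g)
          ∂Measure.pi (fun i => gammaMeasure (a i) 1) :=
        (lintegral_pi_gammaMeasure ha
          (f := fun g => ENNReal.ofReal (∑ i, g i) * f (normalize g)) (by fun_prop)).symm
    _ = ∫⁻ g, ∑ j, ENNReal.ofReal (g j) * f (normalize g)
          ∂Measure.pi (fun i => gammaMeasure (a i) 1) := by
        have hpos : ∀ᵐ g ∂Measure.pi (fun i => gammaMeasure (a i) 1), ∀ i, 0 < g i :=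
          ae_all_iff.2 fun i => (measurePreserving_eval (fun i => gammaMeasure (a i) 1)
            i).quasiMeasurePreserving.ae (ae_pos_gammaMeasure_one (a i))
        refine lintegral_congr_ae ?_
        filter_upwards [hpos] with g hg
        rw [ENNReal.ofReal_sum_of_nonneg fun i _ => (hg i).le, Finset.sum_mul]
    _ = ∑ j, ENNReal.ofReal (a j) * ∫⁻ e, ∫⁻ g, f (normalize (g + e • Pi.single j 1))
          ∂Measure.pi (fun i => gammaMeasure (a i) 1) ∂gammaMeasure 1 1 := by
        rw [lintegral_finsetSum _ fun j _ => by fun_prop]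
        exact Finset.sum_congr rfl fun j _ =>
          lintegral_pi_gammaMeasure_mul_eval ha j (hf.comp measurable_normalize)
    _ = _ := by
        refine Finset.sum_congr rfl fun j _ => ?_
        congr 1
        -- The Gamma vector is again written as radius times `w`. Beta–Gamma algebra replaces the
        -- radius and the exponential by `r (1 - y)` and `r y`, and `normalize` removes the common
        -- factor `r`.
        calc _ = ∫⁻ e, ∫⁻ r, ∫⁻ w, f (normalize (r • w + e • Pi.single j 1))
                ∂dirichletMeasure a ∂gammaMeasure (∑ i, a i) 1 ∂gammaMeasure 1 1 := by
              refine lintegral_congr fun e => ?_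
              exact lintegral_pi_gammaMeasure ha
                (f := fun g => f (normalize (g + e • Pi.single j 1))) (by fun_prop)
          _ = ∫⁻ r, ∫⁻ y, ∫⁻ w, f (normalize ((r * (1 - y)) • w + (r * y) • Pi.single j 1))
                ∂dirichletMeasure a ∂betaMeasure 1 (∑ i, a i)
                ∂gammaMeasure (∑ i, a i + 1) 1 :=
              lintegral_gamma_gamma_one hs (f := fun q => ∫⁻ w, f (normalize
                (q.1 • w + q.2 • Pi.single j 1)) ∂dirichletMeasure a) (by fun_prop)
          _ = ∫⁻ _, ∫⁻ y, ∫⁻ w, f ((1 - y) • w + y • Pi.single j 1)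
                ∂dirichletMeasure a ∂betaMeasure 1 (∑ i, a i)
                ∂gammaMeasure (∑ i, a i + 1) 1 := by
              refine lintegral_congr_ae ?_
              filter_upwards [ae_pos_gammaMeasure_one _] with r hr
              refine lintegral_congr fun y => lintegral_congr_ae ?_
              filter_upwards [ae_sum_eq_one_dirichletMeasure a] with w hw
              rw [mul_smul, mul_smul, ← smul_add, normalize_smul hr.ne']
              simp [Finset.sum_add_distrib, ← Finset.mul_sum, hw]
          _ = _ := by simp

/-! ### The symmetric case and the uniform index -/

/-- The uniform probability on `Fin (k + 1)`. -/
noncomputable def uniformFin (k : ℕ) : Measure (Fin (k + 1)) :=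
  ((k : ℝ≥0∞) + 1)⁻¹ • Measure.count

theorem lintegral_uniformFin (k : ℕ) (f : Fin (k + 1) → ℝ≥0∞) :
    ∫⁻ j, f j ∂uniformFin k = ((k : ℝ≥0∞) + 1)⁻¹ * ∑ j, f j := by
  rw [uniformFin, lintegral_smul_measure, lintegral_count, tsum_fintype, smul_eq_mul]

instance (k : ℕ) : IsProbabilityMeasure (uniformFin k) := by
  constructor
  rw [← lintegral_one, lintegral_uniformFin]
  simp only [Finset.sum_const, Finset.card_univ, Fintype.card_fin, nsmul_eq_mul, mul_one]
  push_cast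
  exact ENNReal.inv_mul_cancel (by simp) (by finiteness)

@[fun_prop]
theorem measurable_single_one : Measurable fun j : Fin (k + 1) => (Pi.single j 1 : _ → ℝ) :=
  Measurable.of_discrete

/-- With equal parameters the weights `a j` are `t` times the uniform ones, so after cancelling `t`
the sum over `j` is an average over a uniform index. -/
theorem map_dirichletMeasure_const {t : ℝ} (ht : 0 < t) :
    (((betaMeasure 1 t).prod (uniformFin k)).prod
      (dirichletMeasure fun _ : Fin (k + 1) => t / ((k : ℝ) + 1))).map
      (fun q => (1 - q.1.1) • q.2 + q.1.1 • (Pi.single q.1.2 1 : Fin (k + 1) → ℝ))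
    = dirichletMeasure fun _ : Fin (k + 1) => t / ((k : ℝ) + 1) := by
  have ha : ∀ _ : Fin (k + 1), 0 < t / ((k : ℝ) + 1) := fun _ => by positivity
  have := isProbabilityMeasure_dirichletMeasure ha
  have := isProbabilityMeasureBeta one_pos ht
  have hsum : ∑ _ : Fin (k + 1), t / ((k : ℝ) + 1) = t := by
    simp; field_simp
  refine Measure.ext_of_lintegral _ fun f hf => ?_
  have key := lintegral_dirichletMeasure_eq_sum ha hf
  rw [hsum, ← Finset.mul_sum] at key
  rw [lintegral_map hf (by fun_prop), lintegral_prod _ (by fun_prop),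
    lintegral_prod_symm _ (by fun_prop), lintegral_uniformFin]
  have h1 : ENNReal.ofReal (t / ((k : ℝ) + 1)) = ENNReal.ofReal t * ((k : ℝ≥0∞) + 1)⁻¹ := by
    rw [ENNReal.ofReal_div_of_pos (by positivity), ENNReal.div_eq_inv_mul, mul_comm]
    congr 2
    rw [ENNReal.ofReal_add (by positivity) zero_le_one]; simp
  rw [h1, mul_assoc] at key
  exact ((ENNReal.mul_right_inj (by simpa using ht) (by finiteness)).1 key).symm

/-! ### Cons and zip for i.i.d. sequences -/

section Sequences

variable {X Z : Type*} [MeasurableSpace X] [MeasurableSpace Z]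

/-- The sequence with head `q.1` and tail `q.2`. -/
def consSeq {X : Type*} (q : X × (ℕ → X)) : ℕ → X
  | 0 => q.1
  | n + 1 => q.2 n

@[simp] theorem consSeq_zero {X : Type*} (q : X × (ℕ → X)) : consSeq q 0 = q.1 := rfl

@[simp] theorem consSeq_succ {X : Type*} (q : X × (ℕ → X)) (n : ℕ) :
    consSeq q (n + 1) = q.2 n := rfl

@[fun_prop]
theorem measurable_consSeq : Measurable (consSeq : X × (ℕ → X) → ℕ → X) := by
  refine measurable_pi_lambda _ fun n => ?_
  cases n <;> simp only [consSeq_zero, consSeq_succ] <;> fun_prop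

theorem prod_infinitePi_map_consSeq (μ : Measure X) [IsProbabilityMeasure μ] :
    (μ.prod (Measure.infinitePi fun _ : ℕ => μ)).map consSeq = Measure.infinitePi fun _ => μ := by
  classical
  refine Measure.eq_infinitePi _ fun s t ht => ?_
  -- Padding with `univ` turns the cylinder over `s` into one over an initial segment, which splits
  -- into the head and the first `N` terms of the tail.
  let u : ℕ → Set X := fun i => if i ∈ s then t i else Set.univ
  have hu : ∀ i, MeasurableSet (u i) := fun i => by
    simp only [u]; split_ifs; exacts [ht i, MeasurableSet.univ]
  obtain ⟨N, hN⟩ : ∃ N, s ⊆ Finset.range (N + 1) :=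
    ⟨s.sup id, fun i hi => Finset.mem_range_succ_iff.2 (Finset.le_sup (f := id) hi)⟩
  have hpre : consSeq ⁻¹' Set.pi s t
      = u 0 ×ˢ Set.pi (Finset.range N) (fun i => u (i + 1)) := by
    ext q
    simp only [Set.mem_preimage, Set.mem_pi, Finset.mem_coe, Set.mem_prod, Finset.mem_range]
    constructor
    · intro h
      refine ⟨?_, fun i _ => ?_⟩
      · by_cases h0 : 0 ∈ s
        · simpa [u, h0] using h 0 h0
        · simp [u, h0]
      · by_cases hi : i + 1 ∈ s
        · simpa [u, hi] using h _ hi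
        · simp [u, hi]
    · rintro ⟨h0, h1⟩ i hi
      rcases i with _ | i
      · simpa [u, hi] using h0
      · have : i < N := by simpa using hN hi
        simpa [u, hi] using h1 i this
  rw [Measure.map_apply measurable_consSeq
    (MeasurableSet.pi s.countable_toSet fun i _ => ht i), hpre, Measure.prod_prod,
    Measure.infinitePi_pi _ fun i _ => hu (i + 1), mul_comm,
    ← Finset.prod_range_succ' (fun i => μ (u i)) N, ← Finset.prod_subset hN]
  · exact Finset.prod_congr rfl fun i hi => by simp [u, hi]
  · intro i _ hi
    simp [u, hi]

/-- Pairing of two sequences. -/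
def zipSeq {ι X Z : Type*} (q : (ι → X) × (ι → Z)) : ι → X × Z := fun i => (q.1 i, q.2 i)

@[fun_prop]
theorem measurable_zipSeq {ι : Type*} : Measurable (zipSeq : (ι → X) × (ι → Z) → ι → X × Z) := by
  unfold zipSeq; fun_prop

theorem infinitePi_prod_infinitePi_map_zipSeq {ι : Type*} (μ : Measure X) (ν : Measure Z)
    [IsProbabilityMeasure μ] [IsProbabilityMeasure ν] :
    ((Measure.infinitePi fun _ : ι => μ).prod (Measure.infinitePi fun _ : ι => ν)).map zipSeq
      = Measure.infinitePi fun _ => μ.prod ν := by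
  -- Both laws are determined by their finite-dimensional marginals, where the claim is the finite
  -- product identity.
  refine (Measure.isProjectiveLimit_infinitePi fun _ : ι => μ.prod ν).unique ?_ |>.symm
  intro I
  have h := (measurePreserving_arrowProdEquivProdArrow X Z I (fun _ => μ) (fun _ => ν)).symm
  beta_reduce
  rw [Measure.map_map (by fun_prop) (by fun_prop), ← h.map_eq,
    ← Measure.infinitePi_map_restrict (μ := fun _ : ι => μ),
    ← Measure.infinitePi_map_restrict (μ := fun _ : ι => ν),
    Measure.map_prod_map _ _ (by fun_prop) (by fun_prop),
    Measure.map_map (MeasurableEquiv.measurable _) (by fun_prop)]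
  rfl

end Sequences

/-! ### Stick-breaking sums and their recursion -/

section Sticks

variable {E : Type*} [AddCommGroup E] [Module ℝ E]

/-- The partial sums of the series `∑ W_j b_j` with stick-breaking weights `W_j`. -/
noncomputable def stickSum (y : ℕ → ℝ) (b : ℕ → E) (m : ℕ) : E :=
  ∑ j ∈ Finset.range m, stickWeight y j • b j

/-- What remains of the stick after `m` breaks. -/
noncomputable def stickRest (y : ℕ → ℝ) (m : ℕ) : ℝ := ∏ k ∈ Finset.range m, (1 - y k)

theorem stickWeight_consSeq_succ (q : ℝ × (ℕ → ℝ)) (n : ℕ) :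
    stickWeight (consSeq q) (n + 1) = (1 - q.1) * stickWeight q.2 n := by
  simp only [stickWeight, Finset.prod_range_succ', consSeq_zero, consSeq_succ]
  ring

theorem stickRest_consSeq_succ (q : ℝ × (ℕ → ℝ)) (n : ℕ) :
    stickRest (consSeq q) (n + 1) = (1 - q.1) * stickRest q.2 n := by
  simp only [stickRest, Finset.prod_range_succ', consSeq_zero, consSeq_succ]
  ring

/-- The first break scales all later ones by `1 - q.1`. A new variable added at the front is thus
the outermost affine map, as the induction in `map_stickIterate` needs. -/
theorem stickSum_consSeq_succ (q : ℝ × (ℕ → ℝ)) (p : E × (ℕ → E)) (m : ℕ) :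
    stickSum (consSeq q) (consSeq p) (m + 1) = (1 - q.1) • stickSum q.2 p.2 m + q.1 • p.1 := by
  rw [stickSum, Finset.sum_range_succ', stickSum, Finset.smul_sum]
  simp only [stickWeight_consSeq_succ, consSeq_succ, consSeq_zero, mul_smul]
  simp [stickWeight]

@[fun_prop]
theorem measurable_stickWeight (j : ℕ) : Measurable fun y => stickWeight y j := by
  unfold stickWeight; fun_prop

@[fun_prop]
theorem measurable_stickRest (m : ℕ) : Measurable fun y => stickRest y m := by
  unfold stickRest; fun_prop

@[fun_prop]
theorem measurable_stickSum [MeasurableSpace E] [MeasurableAdd₂ E] [MeasurableSMul₂ ℝ E] (m : ℕ) :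
    Measurable fun q : (ℕ → ℝ) × (ℕ → E) => stickSum q.1 q.2 m := by
  unfold stickSum; fun_prop

end Sticks

/-! ### Iterating the fixed point equation -/

section FixedPoint

variable {k : ℕ}

/-- The `m`-th iterate of the random map `w ↦ (1 - y) w + y e_j`. -/
noncomputable def stickIterate (m : ℕ) (q : (ℕ → ℝ × Fin (k + 1)) × (Fin (k + 1) → ℝ)) :
    Fin (k + 1) → ℝ :=
  stickSum (fun i => (q.1 i).1) (fun i => Pi.single (q.1 i).2 1) m
    + stickRest (fun i => (q.1 i).1) m • q.2

@[fun_prop]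
theorem measurable_stickIterate (m : ℕ) : Measurable (stickIterate (k := k) m) := by
  unfold stickIterate
  refine Measurable.add ?_ ?_
  · refine (measurable_stickSum m).comp (Measurable.prodMk (by fun_prop) ?_)
    exact measurable_pi_lambda _ fun i => measurable_single_one.comp (by fun_prop)
  · exact Measurable.smul ((measurable_stickRest m).comp (by fun_prop)) (by fun_prop)

theorem stickIterate_succ (m : ℕ) (x : ℝ × Fin (k + 1)) (ω : ℕ → ℝ × Fin (k + 1))
    (w : Fin (k + 1) → ℝ) :
    stickIterate (m + 1) (consSeq (x, ω), w)
      = (1 - x.1) • stickIterate m (ω, w) + x.1 • Pi.single x.2 1 := by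
  have h1 : (fun i => (consSeq (x, ω) i).1) = consSeq (x.1, fun i => (ω i).1) := by
    ext i; cases i <;> rfl
  have h2 : (fun i => (Pi.single (consSeq (x, ω) i).2 1 : Fin (k + 1) → ℝ))
      = consSeq (Pi.single x.2 1, fun i => Pi.single (ω i).2 1) := by
    ext i; cases i <;> rfl
  simp only [stickIterate]
  rw [h1, h2, stickSum_consSeq_succ, stickRest_consSeq_succ, mul_smul, smul_add]
  abel

/-- Induction on `m`: the head of the driving sequence is independent of the previous iterate, which
has law `ν`, so invariance under one step applies. -/
theorem map_stickIterate (θ : Measure (ℝ × Fin (k + 1))) [IsProbabilityMeasure θ]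
    (ν : Measure (Fin (k + 1) → ℝ)) [IsProbabilityMeasure ν]
    (h : (θ.prod ν).map (fun q => (1 - q.1.1) • q.2 + q.1.1 • (Pi.single q.1.2 1 : _ → ℝ)) = ν)
    (m : ℕ) : ((Measure.infinitePi fun _ : ℕ => θ).prod ν).map (stickIterate m) = ν := by
  induction m with
  | zero =>
    have : stickIterate (k := k) 0 = Prod.snd := by
      ext q; simp [stickIterate, stickSum, stickRest]
    rw [this, Measure.map_snd_prod, measure_univ, one_smul]
  | succ m ih =>
    let I : Measure (ℕ → ℝ × Fin (k + 1)) := Measure.infinitePi fun _ => θ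
    have hstep : Measurable fun q : (ℝ × Fin (k + 1)) × (Fin (k + 1) → ℝ) =>
        (1 - q.1.1) • q.2 + q.1.1 • (Pi.single q.1.2 1 : Fin (k + 1) → ℝ) := by fun_prop
    calc (I.prod ν).map (stickIterate (m + 1))
        = (((θ.prod I).map consSeq).prod (ν.map id)).map (stickIterate (m + 1)) := by
          rw [prod_infinitePi_map_consSeq, Measure.map_id]
      _ = ((θ.prod I).prod ν).map (stickIterate (m + 1) ∘ Prod.map consSeq id) := by
          rw [Measure.map_prod_map _ _ measurable_consSeq measurable_id,
            Measure.map_map (by fun_prop) (by fun_prop)]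
      _ = ((θ.prod I).prod ν).map ((fun q => (1 - q.1.1) • q.2 + q.1.1 • Pi.single q.1.2 1) ∘
            Prod.map id (stickIterate m) ∘ MeasurableEquiv.prodAssoc) := by
          congr 1
          ext1 ⟨⟨x, ω⟩, w⟩
          exact stickIterate_succ m x ω w
      _ = ν := by
          rw [← Measure.map_map hstep (by fun_prop), ← Measure.map_map (by fun_prop) (by fun_prop),
            Measure.prodAssoc_prod, ← Measure.map_prod_map _ _ measurable_id (by fun_prop), ih,
            Measure.map_id, h]

/-- The Dirichlet distribution with equal parameters is, for all `m`, the law of the `m`-th stick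
breaking partial sum completed with an independent Dirichlet vector. -/
theorem map_stickSum_add_stickRest {t : ℝ} (ht : 0 < t) (m : ℕ) :
    have ν := dirichletMeasure fun _ : Fin (k + 1) => t / ((k : ℝ) + 1)
    (((Measure.infinitePi fun _ : ℕ => betaMeasure 1 t).prod
      (Measure.infinitePi fun _ : ℕ => uniformFin k)).prod ν).map
      (fun q => stickSum q.1.1 (fun i => (Pi.single (q.1.2 i) 1 : Fin (k + 1) → ℝ)) m
        + stickRest q.1.1 m • q.2) = ν := by
  intro ν
  have ha : ∀ _ : Fin (k + 1), 0 < t / ((k : ℝ) + 1) := fun _ => by positivity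
  have : IsProbabilityMeasure ν := isProbabilityMeasure_dirichletMeasure ha
  have := isProbabilityMeasureBeta one_pos ht
  have h := map_stickIterate _ ν (map_dirichletMeasure_const (k := k) ht) m
  rw [← infinitePi_prod_infinitePi_map_zipSeq] at h
  have hid : ∀ ρ : Measure ((ℕ → ℝ) × (ℕ → Fin (k + 1))), IsProbabilityMeasure ρ →
      (ρ.map zipSeq).prod ν = (ρ.prod ν).map (Prod.map zipSeq id) := fun ρ _ => by
    rw [← Measure.map_prod_map _ _ (by fun_prop) measurable_id, Measure.map_id]
  rw [hid _ inferInstance, Measure.map_map (by fun_prop) (by fun_prop)] at h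
  exact h

end FixedPoint

/-! ### Geometric decay of the remaining stick -/

section Rate

/-- The mean of `1 - Y` for `Y ∼ β(1, t)`. -/
noncomputable def stickRate (t : ℝ) : ℝ≥0∞ := ∫⁻ y, ENNReal.ofReal (1 - y) ∂betaMeasure 1 t

variable {t : ℝ}

theorem ae_mem_Ioo_betaMeasure (t : ℝ) : ∀ᵐ y ∂betaMeasure 1 t, 0 < y ∧ y < 1 := by
  rw [betaMeasure, ae_withDensity_iff (by unfold betaPDF; fun_prop)]
  refine .of_forall fun y hy => ?_
  by_contra h
  exact hy (by rw [betaPDF_eq, if_neg h, ENNReal.ofReal_zero])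

/-- The means of `1 - Y` and `Y` add up to `1`, and the second is positive because `Y > 0` almost
surely. -/
theorem stickRate_lt_one (ht : 0 < t) : stickRate t < 1 := by
  have := isProbabilityMeasureBeta one_pos ht
  have hsum : stickRate t + ∫⁻ y, ENNReal.ofReal y ∂betaMeasure 1 t = 1 := by
    rw [stickRate, ← lintegral_add_left (by fun_prop),
      ← measure_univ (μ := betaMeasure 1 t), ← lintegral_one]
    refine lintegral_congr_ae ?_
    filter_upwards [ae_mem_Ioo_betaMeasure t] with y hy
    rw [← ENNReal.ofReal_add (by linarith) hy.1.le]
    simp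
  have hpos : ∫⁻ y, ENNReal.ofReal y ∂betaMeasure 1 t ≠ 0 := by
    rw [Ne, lintegral_eq_zero_iff (by fun_prop)]
    intro h
    obtain ⟨y, h1, h2⟩ := (h.and (ae_mem_Ioo_betaMeasure t)).exists
    exact h2.1.not_ge (by simpa using h1)
  have hfin : stickRate t ≠ ∞ := fun h => by simp [h] at hsum
  rw [← hsum]
  exact ENNReal.lt_add_right hfin hpos

/-- The law of an i.i.d. sequence of `β(1, t)` variables. -/
noncomputable def stickLaw (t : ℝ) : Measure (ℕ → ℝ) := Measure.infinitePi fun _ => betaMeasure 1 t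

theorem isProbabilityMeasure_stickLaw (ht : 0 < t) : IsProbabilityMeasure (stickLaw t) := by
  have := isProbabilityMeasureBeta one_pos ht
  unfold stickLaw; infer_instance

theorem ae_mem_Ioo_stickLaw (ht : 0 < t) : ∀ᵐ y ∂stickLaw t, ∀ k, 0 < y k ∧ y k < 1 := by
  have := isProbabilityMeasureBeta one_pos ht
  exact ae_all_iff.2 fun k => (measurePreserving_eval_infinitePi (fun _ : ℕ => betaMeasure 1 t)
    k).quasiMeasurePreserving.ae (ae_mem_Ioo_betaMeasure t)

theorem lintegral_prod_stickLaw (ht : 0 < t) (m : ℕ) :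
    ∫⁻ y, ∏ k ∈ Finset.range m, ENNReal.ofReal (1 - y k) ∂stickLaw t = stickRate t ^ m := by
  have := isProbabilityMeasureBeta one_pos ht
  have := isProbabilityMeasure_stickLaw ht
  induction m with
  | zero => simp
  | succ m ih =>
    rw [stickLaw, ← prod_infinitePi_map_consSeq, lintegral_map (by fun_prop) (by fun_prop)]
    simp only [Finset.prod_range_succ', consSeq_zero, consSeq_succ]
    simp only [mul_comm _ (ENNReal.ofReal (1 - Prod.fst _))]
    rw [lintegral_prod_mul (f := fun x => ENNReal.ofReal (1 - x))
      (g := fun y : ℕ → ℝ => ∏ k ∈ Finset.range m, ENNReal.ofReal (1 - y k))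
      (by fun_prop) (Measurable.aemeasurable (by fun_prop)), pow_succ, mul_comm]
    exact congrArg (· * _) ih

theorem enorm_stickRest {y : ℕ → ℝ} (hy : ∀ k, 0 < y k ∧ y k < 1) (m : ℕ) :
    ‖stickRest y m‖ₑ = ∏ k ∈ Finset.range m, ENNReal.ofReal (1 - y k) := by
  have h : ∀ k ∈ Finset.range m, 0 ≤ 1 - y k := fun k _ => by linarith [(hy k).2]
  rw [stickRest, Real.enorm_of_nonneg (Finset.prod_nonneg h), ENNReal.ofReal_prod_of_nonneg h]

theorem lintegral_enorm_stickRest (ht : 0 < t) (m : ℕ) :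
    ∫⁻ y, ‖stickRest y m‖ₑ ∂stickLaw t = stickRate t ^ m := by
  rw [← lintegral_prod_stickLaw ht]
  refine lintegral_congr_ae ?_
  filter_upwards [ae_mem_Ioo_stickLaw ht] with y hy using enorm_stickRest hy m

theorem lintegral_enorm_stickWeight_le (ht : 0 < t) (m : ℕ) :
    ∫⁻ y, ‖stickWeight y m‖ₑ ∂stickLaw t ≤ stickRate t ^ m := by
  rw [← lintegral_enorm_stickRest ht]
  refine lintegral_mono_ae ?_
  filter_upwards [ae_mem_Ioo_stickLaw ht] with y hy
  have : stickWeight y m = y m * stickRest y m := rfl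
  rw [this, enorm_mul]
  refine mul_le_of_le_one_left' ?_
  rw [Real.enorm_of_nonneg (hy m).1.le]
  exact ENNReal.ofReal_le_one.2 (hy m).2.le

/-- The expected sum of all remainders is a convergent geometric series, so the sum is almost surely
finite and its terms tend to `0`. -/
theorem ae_tendsto_stickRest (ht : 0 < t) :
    ∀ᵐ y ∂stickLaw t, Tendsto (stickRest y) atTop (𝓝 0) := by
  have h : ∫⁻ y, ∑' m, ‖stickRest y m‖ₑ ∂stickLaw t ≠ ∞ := by
    rw [lintegral_tsum fun m => by fun_prop]
    simp_rw [lintegral_enorm_stickRest ht]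
    rw [ENNReal.tsum_geometric]
    simpa [tsub_eq_zero_iff_le] using stickRate_lt_one ht
  have hm : Measurable fun y : ℕ → ℝ => ∑' m, ‖stickRest y m‖ₑ := by fun_prop
  filter_upwards [ae_lt_top hm h] with y hy
  rw [tendsto_zero_iff_enorm_tendsto_zero]
  exact ENNReal.tendsto_atTop_zero_of_tsum_ne_top hy.ne

end Rate

/-! ### Truncated norms and Lipschitz functions of bounded oscillation -/

/-- Terms of a convergent series are eventually below `1`, where the truncation does nothing. -/
theorem summable_norm_of_tsum_min_one_ne_top {E : Type*} [NormedAddCommGroup E] {v : ℕ → E}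
    (h : ∑' j, min 1 ‖v j‖ₑ ≠ ∞) :
    Summable fun j => ‖v j‖ := by
  have h0 := ENNReal.tendsto_atTop_zero_of_tsum_ne_top h
  obtain ⟨N, hN⟩ := eventually_atTop.1 (h0.eventually_lt_const one_pos)
  rw [← summable_nat_add_iff N]
  have h1 : ∑' j, ‖v (j + N)‖ₑ ≠ ∞ := by
    have : ∀ j, ‖v (j + N)‖ₑ = min 1 ‖v (j + N)‖ₑ := fun j => by
      have := hN (j + N) (by omega)
      rcases min_lt_iff.1 this with h | h
      · exact absurd h (lt_irrefl _)
      · exact (min_eq_right h.le).symm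
    rw [tsum_congr this]
    exact ne_top_of_le_ne_top h
      (ENNReal.tsum_comp_le_tsum_of_injective (add_left_injective N) fun j => min 1 ‖v j‖ₑ)
  simpa using ENNReal.summable_toReal h1

theorem norm_sub_le_mul_min_one {E : Type*} [NormedAddCommGroup E]
    {f : E → ℝ} {C : ℝ} {L : NNReal}
    (hC : ∀ x y, dist (f x) (f y) ≤ C) (hL : LipschitzWith L f) (x v : E) :
    ‖f (x + v) - f x‖ ≤ (C + L) * (min 1 ‖v‖ₑ).toReal := by
  have h1 := hC (x + v) x
  have h2 := hL.dist_le_mul (x + v) x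
  have hC0 : 0 ≤ C := dist_nonneg.trans h1
  have hL0 : (0 : ℝ) ≤ L := L.2
  rw [Real.dist_eq] at h1 h2
  rw [dist_eq_norm, add_sub_cancel_left] at h2
  rw [Real.norm_eq_abs, ENNReal.toReal_min (by simp) (by simp), ENNReal.toReal_one, toReal_enorm]
  rcases le_total 1 ‖v‖ with h | h
  · rw [min_eq_left h]; linarith
  · rw [min_eq_right h]; nlinarith [norm_nonneg v]

theorem integrable_of_lipschitz_of_dist_le {E : Type*} [NormedAddCommGroup E] [MeasurableSpace E]
    [BorelSpace E] {Ω : Type*} [MeasurableSpace Ω] {P : Measure Ω}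
    [IsFiniteMeasure P] {f : E → ℝ} {C : ℝ} {L : NNReal} (hC : ∀ x y, dist (f x) (f y) ≤ C)
    (hL : LipschitzWith L f) {g : Ω → E} (hg : Measurable g) : Integrable (fun ω => f (g ω)) P := by
  refine Integrable.of_bound (C := ‖f 0‖ + C)
    (hL.continuous.measurable.comp hg).aestronglyMeasurable (.of_forall fun ω => ?_)
  have h1 := hC (g ω) 0
  rw [dist_eq_norm] at h1
  have := norm_add_le (f 0) (f (g ω) - f 0)
  rw [add_sub_cancel] at this
  linarith

/-! ### Tail bounds from the logarithmic moment -/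

section Tail

variable {E : Type*} [NormedAddCommGroup E] [MeasurableSpace E] {t : ℝ}

/-- A bound of `𝔼 min(1, ‖W_j B_j‖)`, where `W` are the stick-breaking weights and `B_j ∼ α`. -/
noncomputable def tailBound (α : Measure E) (t s : ℝ) (j : ℕ) : ℝ≥0∞ :=
  α {x | Real.exp (s * j) < ‖x‖} + ENNReal.ofReal (Real.exp (s * j)) * stickRate t ^ j

/-- A small `s > 0` keeps `exp s * stickRate t < 1`, so the second terms are geometric. The first
are dominated by the tail probabilities at the integers of the integrable variable `log (1 + ‖x‖) /
s`. -/
theorem exists_tsum_tailBound_ne_top (ht : 0 < t) (α : Measure E) [IsProbabilityMeasure α]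
    (hα : Integrable (fun x => Real.log (1 + ‖x‖)) α) :
    ∃ s, ∑' j, tailBound α t s j ≠ ∞ := by
  have hlt := stickRate_lt_one ht
  obtain ⟨s, hs, hs1⟩ : ∃ s : ℝ, 0 < s ∧ ENNReal.ofReal (Real.exp s) * stickRate t < 1 := by
    have hc : Tendsto (fun s : ℝ => ENNReal.ofReal (Real.exp s) * stickRate t) (𝓝[>] 0)
        (𝓝 (ENNReal.ofReal (Real.exp 0) * stickRate t)) := by
      refine ENNReal.Tendsto.mul_const ?_ (.inr hlt.ne_top)
      exact ENNReal.tendsto_ofReal (Real.continuous_exp.continuousWithinAt.tendsto)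
    rw [Real.exp_zero, ENNReal.ofReal_one, one_mul] at hc
    have := (hc.eventually_lt_const hlt).and self_mem_nhdsWithin
    obtain ⟨s, h1, h2⟩ := this.exists
    exact ⟨s, h2, h1⟩
  refine ⟨s, ?_⟩
  simp only [tailBound]
  rw [ENNReal.tsum_add]
  refine ENNReal.add_ne_top.2 ⟨?_, ?_⟩
  -- `tsum_prob_mem_Ioi_lt_top` speaks of the ambient volume, so `α` is made the volume of `E`.
  · let _ : MeasureSpace E := ⟨α⟩
    have : IsProbabilityMeasure (volume : Measure E) := ‹IsProbabilityMeasure α›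
    have h := tsum_prob_mem_Ioi_lt_top (X := fun x : E => Real.log (1 + ‖x‖) / s)
      (hα.div_const s) (fun x => div_nonneg (Real.log_nonneg (by simp)) hs.le)
    refine ne_top_of_le_ne_top h.ne (ENNReal.tsum_le_tsum fun j => measure_mono fun x hx => ?_)
    simp only [Set.mem_ofPred_eq, Set.mem_Ioi] at hx ⊢
    rw [lt_div_iff₀ hs, mul_comm, Real.lt_log_iff_exp_lt (by positivity)]
    linarith
  · have : ∀ j : ℕ, ENNReal.ofReal (Real.exp (s * j)) * stickRate t ^ j
        = (ENNReal.ofReal (Real.exp s) * stickRate t) ^ j := fun j => by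
      rw [mul_pow, mul_comm s, Real.exp_nat_mul, ENNReal.ofReal_pow (Real.exp_pos s).le]
    simp_rw [this]
    rw [ENNReal.tsum_geometric]
    simpa [tsub_eq_zero_iff_le] using hs1

variable [NormedSpace ℝ E] [BorelSpace E]
variable {Ω : Type*} [MeasurableSpace Ω] {P : Measure Ω} {Y : Ω → ℕ → ℝ} {α : Measure E}

/-- Cut at `‖b‖ = exp (s j)`: use the bound `1` above and `exp (s j)` times the weight below. Only
the marginal laws of `Y` and `b` matter, so the bound survives when the points `b j` are repeated.
-/
theorem lintegral_min_one_enorm_le (ht : 0 < t) (hY : Measurable Y) (hYlaw : P.map Y = stickLaw t)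
    {b : Ω → E} (hb : Measurable b) (hblaw : P.map b = α) (s : ℝ) (j : ℕ) :
    ∫⁻ ω, min 1 ‖stickWeight (Y ω) j • b ω‖ₑ ∂P ≤ tailBound α t s j := by
  have hS : MeasurableSet {x : E | Real.exp (s * j) < ‖x‖} :=
    measurableSet_lt measurable_const measurable_norm
  calc ∫⁻ ω, min 1 ‖stickWeight (Y ω) j • b ω‖ₑ ∂P
      ≤ ∫⁻ ω, ({x : E | Real.exp (s * j) < ‖x‖}.indicator 1 (b ω)
          + ENNReal.ofReal (Real.exp (s * j)) * ‖stickWeight (Y ω) j‖ₑ) ∂P := by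
        refine lintegral_mono fun ω => ?_
        by_cases h : Real.exp (s * j) < ‖b ω‖
        · rw [Set.indicator_of_mem (by exact h)]
          exact (min_le_left _ _).trans le_self_add
        · refine (min_le_right _ _).trans (le_add_left ?_)
          rw [enorm_smul, mul_comm]
          gcongr
          rw [← ofReal_norm]
          exact ENNReal.ofReal_le_ofReal (not_lt.1 h)
    _ = α {x | Real.exp (s * j) < ‖x‖}
          + ENNReal.ofReal (Real.exp (s * j)) * ∫⁻ y, ‖stickWeight y j‖ₑ ∂stickLaw t := by
        rw [lintegral_add_left (f := fun ω => {x : E | Real.exp (s * j) < ‖x‖}.indicator 1 (b ω))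
            ((measurable_one.indicator hS).comp hb),
          ← lintegral_map (measurable_one.indicator hS) hb, hblaw, lintegral_indicator_one hS,
          lintegral_const_mul _ (by fun_prop), ← hYlaw, lintegral_map (by fun_prop) hY]
    _ ≤ _ := by
        unfold tailBound
        gcongr
        exact lintegral_enorm_stickWeight_le ht j

theorem ae_summable_norm_stickWeight_smul (ht : 0 < t) (hY : Measurable Y)
    (hYlaw : P.map Y = stickLaw t) {b : ℕ → Ω → E} (hb : ∀ j, Measurable (b j))
    [SecondCountableTopology E]
    (hblaw : ∀ j, P.map (b j) = α) {s : ℝ} (hs : ∑' j, tailBound α t s j ≠ ∞) :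
    ∀ᵐ ω ∂P, Summable fun j => ‖stickWeight (Y ω) j • b j ω‖ := by
  have hm : ∀ j, Measurable fun ω => min 1 ‖stickWeight (Y ω) j • b j ω‖ₑ := fun j => by
    have := hb j
    fun_prop
  have h : ∫⁻ ω, ∑' j, min 1 ‖stickWeight (Y ω) j • b j ω‖ₑ ∂P ≠ ∞ := by
    rw [lintegral_tsum fun j => (hm j).aemeasurable]
    exact ne_top_of_le_ne_top hs (ENNReal.tsum_le_tsum fun j =>
      lintegral_min_one_enorm_le ht hY hYlaw (hb j) (hblaw j) s j)
  filter_upwards [ae_lt_top (Measurable.tsum hm) h] with ω hω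
  exact summable_norm_of_tsum_min_one_ne_top hω.ne

/-- The bound involves neither `P` nor the joint law of the points, hence is uniform in the number
of points of the mixture. -/
theorem norm_integral_stickSum_succ_sub_le [SecondCountableTopology E] (ht : 0 < t)
    [IsFiniteMeasure P]
    (hY : Measurable Y) (hYlaw : P.map Y = stickLaw t) {b : ℕ → Ω → E} (hb : ∀ j, Measurable (b j))
    (hblaw : ∀ j, P.map (b j) = α) {s : ℝ} (hs : ∑' j, tailBound α t s j ≠ ∞)
    {f : E → ℝ} {C : ℝ} {L : NNReal}
    (hC : ∀ x y, dist (f x) (f y) ≤ C) (hL : LipschitzWith L f) (m : ℕ) :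
    ‖∫ ω, f (stickSum (Y ω) (fun j => b j ω) (m + 1)) ∂P
      - ∫ ω, f (stickSum (Y ω) (fun j => b j ω) m) ∂P‖ ≤ (C + L) * (tailBound α t s m).toReal := by
  have hK : 0 ≤ C + L := add_nonneg (dist_nonneg.trans (hC 0 0)) L.2
  have hint : ∀ m, Integrable (fun ω => f (stickSum (Y ω) (fun j => b j ω) m)) P := fun m =>
    integrable_of_lipschitz_of_dist_le hC hL
      ((measurable_stickSum m).comp (hY.prodMk (measurable_pi_lambda _ hb)))
  have hm : Measurable fun ω => min 1 ‖stickWeight (Y ω) m • b m ω‖ₑ := by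
    have := hb m
    fun_prop
  have hle := lintegral_min_one_enorm_le ht hY hYlaw (hb m) (hblaw m) s m
  have hfin : tailBound α t s m ≠ ∞ := ENNReal.ne_top_of_tsum_ne_top hs m
  rw [← integral_sub (hint _) (hint _)]
  calc _ ≤ ∫ ω, (C + L) * (min 1 ‖stickWeight (Y ω) m • b m ω‖ₑ).toReal ∂P := by
        refine norm_integral_le_of_norm_le ?_ (.of_forall fun ω => ?_)
        · refine (integrable_toReal_of_lintegral_ne_top hm.aemeasurable
            (ne_top_of_le_ne_top hfin hle)).const_mul _
        · have : stickSum (Y ω) (fun j => b j ω) (m + 1)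
              = stickSum (Y ω) (fun j => b j ω) m + stickWeight (Y ω) m • b m ω :=
            Finset.sum_range_succ _ _
          rw [this]
          exact norm_sub_le_mul_min_one hC hL _ _
    _ = (C + L) * (∫⁻ ω, min 1 ‖stickWeight (Y ω) m • b m ω‖ₑ ∂P).toReal := by
        rw [integral_const_mul, integral_toReal hm.aemeasurable
          (.of_forall fun ω => (min_le_left _ _).trans_lt (by simp))]
    _ ≤ _ := by
        gcongr

end Tail

/-! ### Exchange of the two limits -/

theorem tendsto_of_tendsto_of_norm_sub_le {p : ℕ → ℕ → ℝ} {q e : ℕ → ℝ} {l : ℝ} {B : ℕ → ℝ}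
    (hB : Summable B) (hpB : ∀ k m, ‖p k (m + 1) - p k m‖ ≤ B m)
    (hpq : ∀ m, Tendsto (fun k => p k m) atTop (𝓝 (q m)))
    (hpe : ∀ k, Tendsto (p k) atTop (𝓝 (e k))) (hq : Tendsto q atTop (𝓝 l)) :
    Tendsto e atTop (𝓝 l) := by
  -- Each limit in `m` is an initial term plus a series of increments; dominated convergence of
  -- these series gives the limit in `k`.
  have telescope : ∀ {u : ℕ → ℝ} {x : ℝ}, (∀ m, ‖u (m + 1) - u m‖ ≤ B m) →
      Tendsto u atTop (𝓝 x) → x = u 0 + ∑' m, (u (m + 1) - u m) := by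
    intro u x hu hx
    have h1 := (Summable.of_norm_bounded hB hu).hasSum.tendsto_sum_nat
    simp only [Finset.sum_range_sub] at h1
    have := tendsto_nhds_unique (hx.sub_const (u 0)) h1
    linarith
  have hqB : ∀ m, ‖q (m + 1) - q m‖ ≤ B m := fun m =>
    le_of_tendsto ((hpq (m + 1)).sub (hpq m)).norm (.of_forall fun k => hpB k m)
  rw [telescope hqB hq, funext fun k => telescope (hpB k) (hpe k)]
  exact (hpq 0).add (tendsto_tsum_of_dominated_convergence hB
    (fun m => (hpq (m + 1)).sub (hpq m)) (.of_forall fun k m => hpB k m))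

/-! ### Collisions among uniform indices -/

section Collision

variable {k : ℕ}

theorem uniformFin_singleton (j : Fin (k + 1)) : uniformFin k {j} = ((k : ℝ≥0∞) + 1)⁻¹ := by
  simp [uniformFin]

theorem infinitePi_uniformFin_eval_eq {i j : ℕ} (hij : i ≠ j) :
    (Measure.infinitePi fun _ : ℕ => uniformFin k) {J | J i = J j} = ((k : ℝ≥0∞) + 1)⁻¹ := by
  have hd : MeasurableSet {p : Fin (k + 1) × Fin (k + 1) | p.1 = p.2} := .of_discrete
  have h : {J : ℕ → Fin (k + 1) | J i = J j}
      = (fun J => (J i, J j)) ⁻¹' {p : Fin (k + 1) × Fin (k + 1) | p.1 = p.2} := rfl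
  have hs : ∀ x, Prod.mk x ⁻¹' {p : Fin (k + 1) × Fin (k + 1) | p.1 = p.2} = {x} := fun x => by
    ext y; simp [eq_comm]
  rw [h, ← Measure.map_apply (by fun_prop) hd, Measure.infinitePi_map_eval_prod hij,
    Measure.prod_apply hd]
  simp [hs, uniformFin_singleton]

/-- The probability that `m` uniform draws from `k + 1` objects are not distinct. -/
theorem infinitePi_uniformFin_not_injOn_le (m : ℕ) :
    (Measure.infinitePi fun _ : ℕ => uniformFin k) {J | ¬ Set.InjOn J (Set.Iio m)}
      ≤ (m : ℝ≥0∞) * (m * ((k : ℝ≥0∞) + 1)⁻¹) := by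
  have hsub : {J : ℕ → Fin (k + 1) | ¬ Set.InjOn J (Set.Iio m)}
      ⊆ ⋃ i ∈ Finset.range m, ⋃ j ∈ Finset.range m, {J | i ≠ j ∧ J i = J j} := by
    intro J hJ
    simp only [Set.mem_ofPred_eq, Set.InjOn, Set.mem_Iio, not_forall] at hJ
    obtain ⟨i, hi, j, hj, h, hne⟩ := hJ
    simp only [Set.mem_iUnion, Finset.mem_range]
    exact ⟨i, hi, j, hj, hne, h⟩
  refine (measure_mono hsub).trans ((measure_biUnion_finset_le _ _).trans ?_)
  calc _ ≤ ∑ i ∈ Finset.range m, ∑ j ∈ Finset.range m, ((k : ℝ≥0∞) + 1)⁻¹ := by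
        refine Finset.sum_le_sum fun i _ => (measure_biUnion_finset_le _ _).trans ?_
        refine Finset.sum_le_sum fun j _ => ?_
        by_cases hij : i = j
        · simp [hij]
        · rw [← infinitePi_uniformFin_eval_eq hij]
          exact measure_mono fun J h => h.2
    _ = _ := by simp

end Collision

/-! ### Comparing integrals of test functions -/

theorem tendsto_integral_sub_integral_add {E Ω : Type*} [NormedAddCommGroup E] [MeasurableSpace E]
    [BorelSpace E] [SecondCountableTopology E] [MeasurableSpace Ω] {P : Measure Ω}
    [IsFiniteMeasure P] {f : E → ℝ} {C : ℝ} {L : NNReal} (hC : ∀ x y, dist (f x) (f y) ≤ C)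
    (hL : LipschitzWith L f) {S R : ℕ → Ω → E} (hS : ∀ m, Measurable (S m))
    (hR : ∀ m, Measurable (R m)) (hlim : ∀ᵐ ω ∂P, Tendsto (fun m => R m ω) atTop (𝓝 0)) :
    Tendsto (fun m => ∫ ω, f (S m ω) ∂P - ∫ ω, f (S m ω + R m ω) ∂P) atTop (𝓝 0) := by
  have hint : ∀ m, ∫ ω, f (S m ω) ∂P - ∫ ω, f (S m ω + R m ω) ∂P
      = ∫ ω, (f (S m ω) - f (S m ω + R m ω)) ∂P := fun m =>
    (integral_sub (integrable_of_lipschitz_of_dist_le hC hL (hS m))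
      (integrable_of_lipschitz_of_dist_le hC hL ((hS m).add (hR m)))).symm
  simp_rw [hint]
  rw [← integral_zero Ω ℝ (μ := P)]
  have hf := hL.continuous.measurable
  refine tendsto_integral_of_dominated_convergence (fun _ => C) (fun m => ?_)
    (integrable_const C) (fun m => .of_forall fun ω => hC _ _) ?_
  · exact ((hf.comp (hS m)).sub (hf.comp ((hS m).add (hR m)))).aestronglyMeasurable
  · filter_upwards [hlim] with ω hω
    have h1 : Tendsto (fun m => (L : ℝ) * ‖R m ω‖) atTop (𝓝 0) := by
      simpa using hω.norm.const_mul (L : ℝ)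
    refine squeeze_zero_norm (fun m => ?_) h1
    rw [← dist_eq_norm, dist_comm]
    refine (hL.dist_le_mul _ _).trans_eq ?_
    rw [dist_eq_norm, add_sub_cancel_left]

theorem norm_integral_sub_apply_zero_le {E Ω : Type*} [NormedAddCommGroup E] [MeasurableSpace E]
    [BorelSpace E] [MeasurableSpace Ω] {P : Measure Ω} [IsProbabilityMeasure P] {f : E → ℝ} {C : ℝ}
    {L : NNReal} (hC : ∀ x y, dist (f x) (f y) ≤ C) (hL : LipschitzWith L f) {g : Ω → E}
    (hg : Measurable g) : ‖∫ ω, f (g ω) ∂P - f 0‖ ≤ C := by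
  have h : ∫ ω, (f (g ω) - f 0) ∂P = ∫ ω, f (g ω) ∂P - f 0 := by
    rw [integral_sub (integrable_of_lipschitz_of_dist_le hC hL hg) (integrable_const _)]
    simp
  rw [← h]
  have hbd : ∀ᵐ ω ∂P, ‖f (g ω) - f 0‖ ≤ C := .of_forall fun ω => hC (g ω) 0
  simpa using norm_integral_le_of_norm_le_const hbd

/-- The two variables live on different spaces, so both integrals are compared with `f 0`; hence the
factor `2`. -/
theorem norm_integral_sub_integral_le {E Ω Ω' : Type*} [NormedAddCommGroup E] [MeasurableSpace E]
    [BorelSpace E] [MeasurableSpace Ω] [MeasurableSpace Ω'] {P : Measure Ω} {P' : Measure Ω'}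
    [IsProbabilityMeasure P] [IsProbabilityMeasure P'] {f : E → ℝ} {C : ℝ} {L : NNReal}
    (hC : ∀ x y, dist (f x) (f y) ≤ C) (hL : LipschitzWith L f) {g : Ω → E} (hg : Measurable g)
    {g' : Ω' → E} (hg' : Measurable g') :
    ‖∫ ω, f (g ω) ∂P - ∫ ω, f (g' ω) ∂P'‖ ≤ 2 * C := by
  have h := norm_sub_le (∫ ω, f (g ω) ∂P - f 0) (∫ ω, f (g' ω) ∂P' - f 0)
  rw [sub_sub_sub_cancel_right] at h
  linarith [norm_integral_sub_apply_zero_le (P := P) hC hL hg,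
    norm_integral_sub_apply_zero_le (P := P') hC hL hg']

theorem measurable_eval_eval {E ι : Type*} [MeasurableSpace E] [Countable ι] [MeasurableSpace ι]
    [DiscreteMeasurableSpace ι] :
    Measurable fun q : ι × (ι → E) => q.2 q.1 :=
  measurable_from_prod_countable_right fun i => measurable_pi_apply i

/-- The linear map `w ↦ ∑ w i • b i` sends the basis vector of index `J j` to `b (J j)`, carrying
the expansion of the weights over to the mixture. -/
theorem sum_smul_stickSum_add {E : Type*} [AddCommGroup E] [Module ℝ E] {k : ℕ}
    (y : ℕ → ℝ) (J : ℕ → Fin (k + 1)) (w : Fin (k + 1) → ℝ)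
    (b : Fin (k + 1) → E) (m : ℕ) :
    ∑ i, (stickSum y (fun j => (Pi.single (J j) 1 : Fin (k + 1) → ℝ)) m + stickRest y m • w) i • b i
      = stickSum y (fun j => b (J j)) m + stickRest y m • ∑ i, w i • b i := by
  simp only [Pi.add_apply, add_smul, Finset.sum_add_distrib, Pi.smul_apply, smul_eq_mul, mul_smul,
    Finset.smul_sum]
  congr 1
  simp only [stickSum, Finset.sum_apply, Finset.sum_smul, Pi.smul_apply, smul_eq_mul, mul_smul]
  rw [Finset.sum_comm]
  refine Finset.sum_congr rfl fun j _ => ?_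
  rw [← Finset.smul_sum]
  simp [Pi.single_apply]

variable {E : Type*} [NormedAddCommGroup E] [NormedSpace ℝ E] [MeasurableSpace E] [BorelSpace E]
  [SecondCountableTopology E] {t : ℝ} {α : Measure E} [IsProbabilityMeasure α]

/-- A stick-breaking sum of distinct elements of an i.i.d. family has the law of the stick-breaking
sum of an i.i.d. finite sequence. -/
theorem integral_stickSum_comp_eq {ι : Type*} {J : ℕ → ι} {m : ℕ} (hJ : Set.InjOn J (Set.Iio m))
    (y : ℕ → ℝ) {f : E → ℝ} (hf : Continuous f) :
    ∫ b, f (stickSum y (fun j => b (J j)) m) ∂(Measure.infinitePi fun _ : ι => α)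
      = ∫ c, f (∑ i : Fin m, stickWeight y i • c i) ∂(Measure.infinitePi fun _ : Fin m => α) := by
  have hinj : Function.Injective fun i : Fin m => J i := fun i j h => Fin.ext (hJ i.2 j.2 h)
  have hm : Measurable fun (c : Fin m → E) => ∑ i : Fin m, stickWeight y i • c i := by fun_prop
  rw [← Measure.map_infinitePi_infinitePi_of_inj (P := fun _ : ι => α) hinj,
    integral_map (measurable_pi_lambda _ fun i => measurable_pi_apply _).aemeasurable
      (hf.measurable.comp hm).aestronglyMeasurable]
  simp only [stickSum, Finset.sum_range]

/-- The law of stick-breaking variables, uniform indices in `Fin (k + 1)`, and a random vector with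
law `ν`, all independent. -/
noncomputable def indexLaw (t : ℝ) (k : ℕ) (ν : Measure (Fin (k + 1) → ℝ)) :
    Measure (((ℕ → ℝ) × (ℕ → Fin (k + 1))) × (Fin (k + 1) → ℝ)) :=
  ((stickLaw t).prod (Measure.infinitePi fun _ => uniformFin k)).prod ν

/-! ### Sticks with repeated points against sticks with fresh points -/

section Coupling

variable {k : ℕ} {ν : Measure (Fin (k + 1) → ℝ)} [IsProbabilityMeasure ν]

theorem isProbabilityMeasure_indexLaw (ht : 0 < t) : IsProbabilityMeasure (indexLaw t k ν) := by
  have := isProbabilityMeasure_stickLaw ht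
  unfold indexLaw; infer_instance

theorem measurePreserving_indexLaw_stick (ht : 0 < t) :
    MeasurePreserving (fun x => x.1.1) (indexLaw t k ν) (stickLaw t) := by
  have := isProbabilityMeasure_stickLaw ht
  exact measurePreserving_fst.comp measurePreserving_fst

theorem measurePreserving_indexLaw_index (ht : 0 < t) :
    MeasurePreserving (fun x => x.1.2) (indexLaw t k ν)
      (Measure.infinitePi fun _ => uniformFin k) := by
  have := isProbabilityMeasure_stickLaw ht
  exact measurePreserving_snd.comp measurePreserving_fst

theorem measurePreserving_indexLaw_prod_stick {X : Type*} [MeasurableSpace X] {ρ : Measure X}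
    [IsProbabilityMeasure ρ] (ht : 0 < t) :
    MeasurePreserving (fun x : (((ℕ → ℝ) × (ℕ → Fin (k + 1))) × (Fin (k + 1) → ℝ)) ×
      (Fin (k + 1) → X) => x.1.1.1) ((indexLaw t k ν).prod (Measure.pi fun _ => ρ)) (stickLaw t) :=
  have : IsProbabilityMeasure (indexLaw t k ν) := isProbabilityMeasure_indexLaw ht
  (measurePreserving_indexLaw_stick ht).comp measurePreserving_fst

/-- The index is independent of the points, and for each fixed index the coordinate has law `ρ`. -/
theorem measurePreserving_indexLaw_prod_eval {X : Type*} [MeasurableSpace X] {ρ : Measure X}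
    [IsProbabilityMeasure ρ] (ht : 0 < t) (j : ℕ) :
    MeasurePreserving (fun x : (((ℕ → ℝ) × (ℕ → Fin (k + 1))) × (Fin (k + 1) → ℝ)) ×
      (Fin (k + 1) → X) => x.2 (x.1.1.2 j)) ((indexLaw t k ν).prod (Measure.pi fun _ => ρ)) ρ := by
  have : IsProbabilityMeasure (indexLaw t k ν) := isProbabilityMeasure_indexLaw ht
  have hb : Measurable fun x : (((ℕ → ℝ) × (ℕ → Fin (k + 1))) × (Fin (k + 1) → ℝ)) ×
      (Fin (k + 1) → X) => x.2 (x.1.1.2 j) :=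
    measurable_eval_eval.comp
      (f := fun x : (((ℕ → ℝ) × (ℕ → Fin (k + 1))) × (Fin (k + 1) → ℝ)) × (Fin (k + 1) → X) =>
        (x.1.1.2 j, x.2)) (by fun_prop)
  refine ⟨hb, Measure.ext_of_lintegral _ fun h hh => ?_⟩
  have hhb : Measurable fun x : (((ℕ → ℝ) × (ℕ → Fin (k + 1))) × (Fin (k + 1) → ℝ)) ×
      (Fin (k + 1) → X) => h (x.2 (x.1.1.2 j)) := hh.comp hb
  have hi : ∀ i, ∫⁻ b, h (b i) ∂(Measure.pi fun _ : Fin (k + 1) => ρ) = ∫⁻ x, h x ∂ρ := fun i =>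
    (measurePreserving_eval _ i).lintegral_comp hh
  rw [lintegral_map hh hb, lintegral_prod _ hhb.aemeasurable]
  simp [hi]

theorem measurable_stickSum_eval {ι : Type*} (y : ℕ → ℝ) (J : ℕ → ι) (m : ℕ) :
    Measurable fun b : ι → E => stickSum y (fun j => b (J j)) m := by
  unfold stickSum
  exact Finset.measurable_fun_sum _ fun j _ => (measurable_pi_apply (J j)).const_smul _

theorem measurable_stickSum_comp (m : ℕ) :
    Measurable fun x : (((ℕ → ℝ) × (ℕ → Fin (k + 1))) × (Fin (k + 1) → ℝ)) × (Fin (k + 1) → E) =>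
      stickSum x.1.1.1 (fun j => x.2 (x.1.1.2 j)) m := by
  refine (measurable_stickSum m).comp (Measurable.prodMk (by fun_prop) ?_)
  exact measurable_pi_lambda _ fun j => measurable_eval_eval.comp
    (f := fun x : (((ℕ → ℝ) × (ℕ → Fin (k + 1))) × (Fin (k + 1) → ℝ)) × (Fin (k + 1) → E) =>
      (x.1.1.2 j, x.2)) (by fun_prop)

/-- Condition on the sticks and the indices. If the first `m` indices are distinct, the two
conditional integrals agree; otherwise they differ by at most `2 * C`, on an event controlled by the
collision bound. -/
theorem norm_integral_stickSum_comp_sub_le (ht : 0 < t) {f : E → ℝ} {C : ℝ} {L : NNReal}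
    (hC : ∀ x y, dist (f x) (f y) ≤ C) (hL : LipschitzWith L f) (m : ℕ) :
    ‖∫ x, f (stickSum x.1.1.1 (fun j => x.2 (x.1.1.2 j)) m)
        ∂((indexLaw t k ν).prod (Measure.pi fun _ => α))
      - ∫ x, f (stickSum x.1 x.2 m) ∂((stickLaw t).prod (Measure.infinitePi fun _ : ℕ => α))‖
    ≤ 2 * C * (m * (m * ((k : ℝ) + 1)⁻¹)) := by
  have := isProbabilityMeasure_stickLaw ht
  have hA : IsProbabilityMeasure (indexLaw t k ν) := isProbabilityMeasure_indexLaw ht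
  have hC0 : 0 ≤ C := dist_nonneg.trans (hC 0 0)
  have hi1 := integrable_of_lipschitz_of_dist_le
    (P := (indexLaw t k ν).prod (Measure.pi fun _ => α)) hC hL
    (measurable_stickSum_comp (E := E) (k := k) m)
  have hi2 := integrable_of_lipschitz_of_dist_le
    (P := (stickLaw t).prod (Measure.infinitePi fun _ : ℕ => α)) hC hL (measurable_stickSum m)
  let g : (ℕ → ℝ) → ℝ := fun y => ∫ b, f (stickSum y b m) ∂(Measure.infinitePi fun _ : ℕ => α)
  have hg : Integrable g (stickLaw t) := hi2.integral_prod_left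
  have hmp := measurePreserving_indexLaw_stick (ν := ν) (k := k) ht
  have hgA : ∫ y, g y ∂stickLaw t = ∫ x, g x.1.1 ∂indexLaw t k ν := by
    rw [← hmp.map_eq, integral_map hmp.measurable.aemeasurable
      (hmp.map_eq.symm ▸ hg.aestronglyMeasurable)]
  let S : Set (((ℕ → ℝ) × (ℕ → Fin (k + 1))) × (Fin (k + 1) → ℝ)) :=
    {x | ¬ Set.InjOn x.1.2 (Set.Iio m)}
  have hSm' : MeasurableSet {J : ℕ → Fin (k + 1) | ¬ Set.InjOn J (Set.Iio m)} := by
    refine MeasurableSet.compl (s := {J : ℕ → Fin (k + 1) | Set.InjOn J (Set.Iio m)}) ?_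
    simp only [Set.InjOn, Set.ofPred_forall]
    refine MeasurableSet.iInter fun i => MeasurableSet.iInter fun _ => MeasurableSet.iInter
      fun j => MeasurableSet.iInter fun _ => ?_
    by_cases hij : i = j
    · simp [hij]
    · simp only [hij, imp_false]
      exact (measurableSet_eq_fun (measurable_pi_apply i) (measurable_pi_apply j)).compl
  have hmpJ := measurePreserving_indexLaw_index (ν := ν) (k := k) ht
  have hSm : MeasurableSet S := hmpJ.measurable hSm'
  have hSle : (indexLaw t k ν).real S ≤ m * (m * ((k : ℝ) + 1)⁻¹) := by
    have h1 : indexLaw t k ν S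
        = (Measure.infinitePi fun _ => uniformFin k) {J | ¬ Set.InjOn J (Set.Iio m)} :=
      hmpJ.measure_preimage hSm'.nullMeasurableSet
    have h2 := infinitePi_uniformFin_not_injOn_le (k := k) m
    rw [← h1] at h2
    have h3 := ENNReal.toReal_mono (by finiteness) h2
    simpa [Measure.real, ENNReal.toReal_add] using h3
  rw [integral_prod _ hi1, integral_prod _ hi2, hgA]
  have hg' : Integrable (fun x => g x.1.1) (indexLaw t k ν) := hmp.integrable_comp_of_integrable hg
  rw [← integral_sub hi1.integral_prod_left hg']
  calc _ ≤ ∫ x, S.indicator (fun _ => 2 * C) x ∂indexLaw t k ν := by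
        refine norm_integral_le_of_norm_le ((integrable_const (2 * C)).indicator hSm)
          (.of_forall fun x => ?_)
        by_cases hx : x ∈ S
        · rw [Set.indicator_of_mem hx]
          exact norm_integral_sub_integral_le (P := Measure.pi fun _ : Fin (k + 1) => α)
            (P' := Measure.infinitePi fun _ : ℕ => α)
            (g := fun b => stickSum x.1.1 (fun j => b (x.1.2 j)) m)
            (g' := fun b => stickSum x.1.1 b m) hC hL
            (measurable_stickSum_eval x.1.1 x.1.2 m) (measurable_stickSum_eval x.1.1 id m)
        · rw [Set.indicator_of_notMem hx]
          have hinj : Set.InjOn x.1.2 (Set.Iio m) := not_not.1 hx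
          -- Both integrals equal the one over `Fin m → E`; the i.i.d. sequence is the case `J =
          -- id`.
          have h1 := integral_stickSum_comp_eq (α := α) hinj x.1.1 hL.continuous
          have h2 := integral_stickSum_comp_eq (α := α) (J := id) (m := m) (Set.injOn_id _) x.1.1
            hL.continuous
          rw [← h2, Measure.infinitePi_eq_pi] at h1
          simp only [h1, g, id, sub_self, norm_zero, le_refl]
    _ = 2 * C * (indexLaw t k ν).real S := by
        rw [integral_indicator_const _ hSm, smul_eq_mul, mul_comm]
    _ ≤ _ := by gcongr

/-- The mixture has the law of the truncated sum plus remainder for every `m`, so only the vanishing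
remainder separates the integrals from their limit. -/
theorem tendsto_integral_stickSum_comp (ht : 0 < t) {f : E → ℝ} {C : ℝ} {L : NNReal}
    (hC : ∀ x y, dist (f x) (f y) ≤ C) (hL : LipschitzWith L f) :
    have ν := dirichletMeasure fun _ : Fin (k + 1) => t / ((k : ℝ) + 1)
    Tendsto (fun m => ∫ x, f (stickSum x.1.1.1 (fun j => x.2 (x.1.1.2 j)) m)
        ∂((indexLaw t k ν).prod (Measure.pi fun _ => α))) atTop
      (𝓝 (∫ x, f (∑ i, x.1 i • x.2 i) ∂(ν.prod (Measure.pi fun _ => α)))) := by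
  intro ν
  have hν : IsProbabilityMeasure ν :=
    isProbabilityMeasure_dirichletMeasure fun _ => by positivity
  have := isProbabilityMeasure_stickLaw ht
  have hA : IsProbabilityMeasure (indexLaw t k ν) := isProbabilityMeasure_indexLaw ht
  have hf := hL.continuous
  let v : (((ℕ → ℝ) × (ℕ → Fin (k + 1))) × (Fin (k + 1) → ℝ)) × (Fin (k + 1) → E) → E :=
    fun x => ∑ i, x.1.2 i • x.2 i
  have hv : Measurable v := by fun_prop
  have heq : ∀ m, ∫ x, f (∑ i, x.1 i • x.2 i) ∂(ν.prod (Measure.pi fun _ => α))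
      = ∫ x, f (stickSum x.1.1.1 (fun j => x.2 (x.1.1.2 j)) m + stickRest x.1.1.1 m • v x)
        ∂((indexLaw t k ν).prod (Measure.pi fun _ => α)) := by
    intro m
    have hm : Measurable fun q : ((ℕ → ℝ) × (ℕ → Fin (k + 1))) × (Fin (k + 1) → ℝ) =>
        stickSum q.1.1 (fun i => (Pi.single (q.1.2 i) 1 : Fin (k + 1) → ℝ)) m
          + stickRest q.1.1 m • q.2 := by
      refine Measurable.add ((measurable_stickSum m).comp (Measurable.prodMk (by fun_prop) ?_)) ?_
      · exact measurable_pi_lambda _ fun i => measurable_single_one.comp (by fun_prop)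
      · exact ((measurable_stickRest m).comp (by fun_prop)).smul (by fun_prop)
    have h := map_stickSum_add_stickRest (k := k) ht m
    have h' : ν.prod (Measure.pi fun _ : Fin (k + 1) => α) = ((indexLaw t k ν).prod
        (Measure.pi fun _ => α)).map (Prod.map (fun q => stickSum q.1.1
          (fun i => (Pi.single (q.1.2 i) 1 : Fin (k + 1) → ℝ)) m
            + stickRest q.1.1 m • q.2) id) := by
      rw [← Measure.map_prod_map _ _ hm measurable_id, Measure.map_id]
      exact congrArg (fun ρ => Measure.prod ρ _) h.symm
    have hmix : Measurable fun x : (Fin (k + 1) → ℝ) × (Fin (k + 1) → E) =>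
        f (∑ i, x.1 i • x.2 i) := hf.measurable.comp (by fun_prop)
    rw [h', integral_map (hm.prodMap measurable_id).aemeasurable
      hmix.aestronglyMeasurable]
    refine integral_congr_ae (.of_forall fun x => ?_)
    exact congrArg f (sum_smul_stickSum_add x.1.1.1 x.1.1.2 x.1.2 x.2 m)
  have hmp := measurePreserving_indexLaw_prod_stick (k := k) (ν := ν) (ρ := α) ht
  have hlim : ∀ᵐ x ∂((indexLaw t k ν).prod (Measure.pi fun _ => α)),
      Tendsto (fun m => stickRest x.1.1.1 m • v x) atTop (𝓝 0) := by
    filter_upwards [hmp.quasiMeasurePreserving.ae (ae_tendsto_stickRest ht)] with x hx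
    simpa using hx.smul_const (v x)
  have hdiff := tendsto_integral_sub_integral_add hC hL measurable_stickSum_comp
    (fun m => ((measurable_stickRest m).comp hmp.measurable).smul hv) hlim
  have hfin := hdiff.add_const (∫ x, f (∑ i, x.1 i • x.2 i) ∂(ν.prod (Measure.pi fun _ => α)))
  rw [zero_add] at hfin
  refine hfin.congr fun m => ?_
  rw [heq m]
  exact sub_add_cancel _ _

end Coupling

/-! ### Convergence to the Dirichlet curve -/

variable {d : ℕ} {α : ProbabilityMeasure (EuclideanSpace ℝ (Fin d))} {t : ℝ}

theorem drivingLaw_map_fst (ht : 0 < t) :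
    (drivingLaw α t).map (fun ω k => (ω k).1) = stickLaw t := by
  have := isProbabilityMeasureBeta one_pos ht
  rw [drivingLaw, Measure.infinitePi_map_pi (f := fun _ => Prod.fst) _ fun _ => measurable_fst]
  simp [stickLaw]

theorem drivingLaw_map_eval_snd (ht : 0 < t) (j : ℕ) :
    (drivingLaw α t).map (fun ω => (ω j).2) = α := by
  have := isProbabilityMeasureBeta one_pos ht
  have h := measurePreserving_snd.comp (measurePreserving_eval_infinitePi
    (fun _ : ℕ => (betaMeasure 1 t).prod (α : Measure (EuclideanSpace ℝ (Fin d)))) j)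
  exact h.map_eq

theorem ae_summable_norm_meanTerm (hα : α ∈ FT d) (ht : 0 < t) :
    ∀ᵐ ω ∂drivingLaw α t, Summable fun n => ‖meanTerm ω n‖ := by
  obtain ⟨s, hs⟩ := exists_tsum_tailBound_ne_top ht
    (α : Measure (EuclideanSpace ℝ (Fin d))) hα
  exact ae_summable_norm_stickWeight_smul (P := drivingLaw α t) (Y := fun ω k => (ω k).1)
    (b := fun j ω => (ω j).2) ht (by fun_prop) (drivingLaw_map_fst ht) (fun j => by fun_prop)
    (drivingLaw_map_eval_snd ht) hs

theorem tendsto_integral_stickSum_drivingLaw (hα : α ∈ FT d) (ht : 0 < t)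
    {f : EuclideanSpace ℝ (Fin d) → ℝ} {C : ℝ} {L : NNReal}
    (hC : ∀ x y, dist (f x) (f y) ≤ C) (hL : LipschitzWith L f) :
    Tendsto (fun m => ∫ x, f (stickSum x.1 x.2 m) ∂((stickLaw t).prod
        (Measure.infinitePi fun _ : ℕ => (α : Measure (EuclideanSpace ℝ (Fin d))))))
      atTop (𝓝 (∫ x, f x ∂(dirichletCurve α t ht : Measure (EuclideanSpace ℝ (Fin d))))) := by
  have := isProbabilityMeasureBeta one_pos ht
  have := isProbabilityMeasure_drivingLaw α t ht
  have hf := hL.continuous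
  have hm : ∀ m, Measurable fun ω : ℕ → ℝ × EuclideanSpace ℝ (Fin d) =>
      ∑ j ∈ Finset.range m, meanTerm ω j := fun m =>
    Finset.measurable_fun_sum _ fun j _ => measurable_meanTerm j
  have hfm : ∀ m, Measurable fun ω : ℕ → ℝ × EuclideanSpace ℝ (Fin d) =>
      f (∑ j ∈ Finset.range m, meanTerm ω j) := fun m => hf.measurable.comp (hm m)
  have h1 : ∀ m, ∫ x, f (stickSum x.1 x.2 m) ∂((stickLaw t).prod
        (Measure.infinitePi fun _ : ℕ => (α : Measure (EuclideanSpace ℝ (Fin d)))))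
      = ∫ ω, f (∑ j ∈ Finset.range m, meanTerm ω j) ∂drivingLaw α t := by
    intro m
    -- Zipping the sticks with the points turns the product law into the driving law.
    rw [drivingLaw, ← infinitePi_prod_infinitePi_map_zipSeq, integral_map (by fun_prop)
      (hfm m).aestronglyMeasurable]
    rfl
  have h2 : ∫ x, f x ∂(dirichletCurve α t ht : Measure (EuclideanSpace ℝ (Fin d)))
      = ∫ ω, f (dirichletMean ω) ∂drivingLaw α t :=
    integral_map measurable_dirichletMean.aemeasurable hf.measurable.aestronglyMeasurable
  rw [h2]
  simp_rw [h1]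
  refine tendsto_integral_of_dominated_convergence (fun _ => ‖f 0‖ + C) (fun m => ?_)
    (integrable_const _) (fun m => .of_forall fun ω => ?_) ?_
  · exact (hfm m).aestronglyMeasurable
  · have h := norm_add_le (f 0) (f (∑ j ∈ Finset.range m, meanTerm ω j) - f 0)
    rw [add_sub_cancel, ← dist_eq_norm] at h
    linarith [hC (∑ j ∈ Finset.range m, meanTerm ω j) 0]
  · filter_upwards [ae_summable_norm_meanTerm hα ht] with ω hω
    exact (hf.tendsto _).comp hω.of_norm.hasSum.tendsto_sum_nat

/-- The law of a Dirichlet mixture of i.i.d. points converges to the Dirichlet curve, tested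
against bounded Lipschitz functions. -/
theorem tendsto_integral_dirichlet_mixture (hα : α ∈ FT d) (ht : 0 < t)
    {f : EuclideanSpace ℝ (Fin d) → ℝ} {C : ℝ} {L : NNReal}
    (hC : ∀ x y, dist (f x) (f y) ≤ C) (hL : LipschitzWith L f) :
    Tendsto (fun k : ℕ => ∫ x, f (∑ i, x.1 i • x.2 i)
        ∂((dirichletMeasure fun _ : Fin (k + 1) => t / ((k : ℝ) + 1)).prod
          (Measure.pi fun _ => (α : Measure (EuclideanSpace ℝ (Fin d)))))) atTop
      (𝓝 (∫ x, f x ∂(dirichletCurve α t ht : Measure (EuclideanSpace ℝ (Fin d))))) := by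
  obtain ⟨s, hs⟩ := exists_tsum_tailBound_ne_top ht
    (α : Measure (EuclideanSpace ℝ (Fin d))) hα
  have hν (k : ℕ) : IsProbabilityMeasure
      (dirichletMeasure fun _ : Fin (k + 1) => t / ((k : ℝ) + 1)) :=
    isProbabilityMeasure_dirichletMeasure fun _ => by positivity
  have hI (k : ℕ) : IsProbabilityMeasure
      (indexLaw t k (dirichletMeasure fun _ : Fin (k + 1) => t / ((k : ℝ) + 1))) :=
    isProbabilityMeasure_indexLaw ht
  refine tendsto_of_tendsto_of_norm_sub_le
    (p := fun k m => ∫ x, f (stickSum x.1.1.1 (fun j => x.2 (x.1.1.2 j)) m)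
      ∂((indexLaw t k (dirichletMeasure fun _ : Fin (k + 1) => t / ((k : ℝ) + 1))).prod
        (Measure.pi fun _ => (α : Measure (EuclideanSpace ℝ (Fin d))))))
    (B := fun m => (C + L) * (tailBound (α : Measure (EuclideanSpace ℝ (Fin d))) t s m).toReal)
    ((ENNReal.summable_toReal hs).mul_left _) (fun k m => ?_) (fun m => ?_)
    (fun k => tendsto_integral_stickSum_comp ht hC hL)
    (tendsto_integral_stickSum_drivingLaw hα ht hC hL)
  · have hY := measurePreserving_indexLaw_prod_stick (k := k) (ν := dirichletMeasure
      fun _ : Fin (k + 1) => t / ((k : ℝ) + 1)) (ρ := (α : Measure (EuclideanSpace ℝ (Fin d)))) ht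
    have hb := measurePreserving_indexLaw_prod_eval (k := k) (ν := dirichletMeasure
      fun _ : Fin (k + 1) => t / ((k : ℝ) + 1)) (ρ := (α : Measure (EuclideanSpace ℝ (Fin d)))) ht
    exact norm_integral_stickSum_succ_sub_le ht hY.measurable hY.map_eq
      (fun j => (hb j).measurable) (fun j => (hb j).map_eq) hs hC hL m
  · rw [tendsto_iff_norm_sub_tendsto_zero]
    refine squeeze_zero (fun _ => norm_nonneg _)
      (fun k => norm_integral_stickSum_comp_sub_le ht hC hL m) ?_
    have h : Tendsto (fun k : ℕ => ((k : ℝ) + 1)⁻¹) atTop (𝓝 0) := by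
      simpa using tendsto_one_div_add_atTop_nhds_zero_nat (𝕜 := ℝ)
    simpa using ((h.const_mul (m : ℝ)).const_mul (m : ℝ)).const_mul (2 * C)

end DirichletCurve

theorem proposition4p1 {d : ℕ} (α : ProbabilityMeasure (EuclideanSpace ℝ (Fin d)))
    (hα : α ∈ DirichletCurve.FT d) (t : ℝ) (ht : 0 < t)
    {Ω : ℕ → Type*} [∀ n, MeasurableSpace (Ω n)]
    (P : ∀ n, Measure (Ω n)) [∀ n, IsProbabilityMeasure (P n)]
    (W : ∀ n, Ω n → Fin (n + 1) → ℝ)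
    (B : ∀ n, Fin (n + 1) → Ω n → EuclideanSpace ℝ (Fin d))
    (hW : ∀ n, HasLaw (W n)
      (DirichletCurve.dirichletMeasure fun _ : Fin (n + 1) => t / ((n : ℝ) + 1)) (P n))
    (hB : ∀ n j, HasLaw (B n j) (α : Measure (EuclideanSpace ℝ (Fin d))) (P n))
    (hBindep : ∀ n, iIndepFun (B n) (P n))
    (hWB : ∀ n, IndepFun (W n) (fun ω j => B n j ω) (P n)) :
    (∀ᵐ ω ∂(DirichletCurve.drivingLaw α t),
      Summable fun n => ‖DirichletCurve.meanTerm ω n‖) ∧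
    TendstoInDistribution (fun n ω => ∑ j, W n ω j • B n j ω) atTop
      (fun x : EuclideanSpace ℝ (Fin d) => x) P
      (DirichletCurve.dirichletCurve α t ht : Measure (EuclideanSpace ℝ (Fin d))) := by
  refine ⟨DirichletCurve.ae_summable_norm_meanTerm hα ht, ?_⟩
  have hBm : ∀ n, AEMeasurable (fun ω j => B n j ω) (P n) := fun n =>
    aemeasurable_pi_iff.2 fun j => (hB n j).aemeasurable
  have hWBm : ∀ n, AEMeasurable (fun ω => (W n ω, fun j => B n j ω)) (P n) := fun n =>
    (hW n).aemeasurable.prodMk (hBm n)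
  have hmix : ∀ n, Measurable fun x : (Fin (n + 1) → ℝ) ×
      (Fin (n + 1) → EuclideanSpace ℝ (Fin d)) =>
      ∑ i, x.1 i • x.2 i := fun n => by fun_prop
  -- The independence hypotheses determine the joint law of weights and points, so the abstract
  -- spaces `Ω n` can be replaced by product measures.
  have hlaw : ∀ n, (P n).map (fun ω => (W n ω, fun j => B n j ω))
      = (DirichletCurve.dirichletMeasure fun _ : Fin (n + 1) => t / ((n : ℝ) + 1)).prod
        (Measure.pi fun _ => (α : Measure (EuclideanSpace ℝ (Fin d)))) := fun n => by
    rw [(indepFun_iff_map_prod_eq_prod_map_map (hW n).aemeasurable (hBm n)).1 (hWB n),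
      (hW n).map_eq, (iIndepFun_iff_map_fun_eq_pi_map fun j => (hB n j).aemeasurable).1 (hBindep n)]
    simp_rw [(hB n _).map_eq]
  have hMm : ∀ n, AEMeasurable (fun ω => ∑ j, W n ω j • B n j ω) (P n) := fun n =>
    (hmix n).comp_aemeasurable (hWBm n)
  refine ⟨hMm, by fun_prop, ?_⟩
  -- Convergence in law is tested on Lipschitz functions of bounded oscillation. The index `n`
  -- stands for `n + 1` points.
  refine tendsto_iff_forall_lipschitz_integral_tendsto.2 ?_
  rintro f ⟨C, hC⟩ ⟨L, hL⟩
  have hf := hL.continuous.measurable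
  have hfmix : ∀ n, Measurable fun x : (Fin (n + 1) → ℝ) ×
      (Fin (n + 1) → EuclideanSpace ℝ (Fin d)) =>
      f (∑ i, x.1 i • x.2 i) := fun n => hf.comp (hmix n)
  have key := DirichletCurve.tendsto_integral_dirichlet_mixture hα ht hC hL
  simp only [ProbabilityMeasure.coe_mk, Measure.map_id']
  refine key.congr fun n => ?_
  rw [← hlaw n, integral_map (hWBm n) (hfmix n).aestronglyMeasurable,
    integral_map (hMm n) hf.aestronglyMeasurable]
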